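/- Let $K=\mathbb{Q}(\sqrt{-3})$ with ring of integers $\mathcal{O}_K=\mathbb{Z}[\omega]$, where $\omega=\frac{1+\sqrt{-3}}{2}$ is a primitive sixth root of unity. For an ideal $\mathfrak{a}$ of $\mathcal{O}_K$ that is prime and coprime to $6$, and $\alpha\in\mathcal{O}_K\setminus\mathfrak{a}$, let $\left(\frac{\alpha}{\mathfrak{a}}\right)_6$ be the sextic residue symbol, i.e. the unique sixth root of unity congruent to $\alpha^{(\mathrm{N}\mathfrak{a}-1)/6}$ modulo $\mathfrak{a}$. Let $k$ be a nonzero integer, let $E/\mathbb{Q}$ be the elliptic curve $y^2=x^3+k$, and let $p\ge5$ and $q\ge5$ be primes of good reduction for $E$ such that $\#\tilde E_p(\mathbb{F}_p)=q$. Let $\mathfrak{p}$ be a prime ideal of $\mathcal{O}_K$ containing $p$. Then there is exactly one $\pi\in\mathcal{O}_K$ such that $\pi\mathcal{O}_K=\mathfrak{p}$ and $\#\tilde E_{\mathfrak{p}}(\mathbb{F}_{\mathfrak{p}})=\mathrm{N}_{K/\mathbb{Q}}(\mathfrak{p})+1-\mathrm{Tr}_{K/\mathbb{Q}}(\pi)$;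 this $\pi$ is the value $\psi_E(\mathfrak{p})$ at $\mathfrak{p}$ of the Grössencharacter $\psi_E$ of $E$. Put $\mathfrak{q}=(1-\psi_E(\mathfrak{p}))\mathcal{O}_K$. Then: (a) If $p\nmid k$, then $\left(\frac{k}{\mathfrak{p}}\right)_6=\omega$ or $\left(\frac{k}{\mathfrak{p}}\right)_6=\omega^5$. (b) $\left(\frac{2}{\mathfrak{p}}\right)_6\left(\frac{2}{\mathfrak{q}}\right)_6=\left(\frac{2}{p}\right)\left(\frac{2}{q}\right)$, where the symbols on the right are Legendre symbols; in particular $\left(\frac{2}{\mathfrak{p}}\right)_6\left(\frac{2}{\mathfrak{q}}\right)_6=\pm1$. -/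

import Mathlib

open NumberField IsDedekindDomain

noncomputable section

/-- The curve `y² = x³ + k` over `ℚ`. -/
def mordellCurve (k : ℤ) : WeierstrassCurve ℚ where
  a₁ := 0
  a₂ := 0
  a₃ := 0
  a₄ := 0
  a₆ := (k : ℚ)

section LocalReduction

variable (R : Type*) [CommRing R] [IsDomain R] [IsDiscreteValuationRing R]
  {F : Type*} [Field F] [Algebra R F] [IsFractionRing R F]

/-- A curve over the fraction field `F` of a discrete valuation ring `R` has good reduction if its
minimal Weierstrass equations have unit discriminant. (The given equation need not be minimal.) -/
def CurveHasGoodReduction (W : WeierstrassCurve F) : Prop :=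
  (W.minimal R).HasGoodReduction R

/-- The number of points, with coordinates in the residue field of `R`, of the reduction of (a
minimal Weierstrass equation of) a curve over the fraction field of `R`. -/
def reductionPointCount (W : WeierstrassCurve F) : ℕ :=
  Nat.card ((W.minimal R).reduction R).toAffine.Point

end LocalReduction

/-- `E / ℚ` has good reduction at the prime number `p`. -/
def GoodReductionAt (E : WeierstrassCurve ℚ) (p : ℕ) [Fact p.Prime] : Prop :=
  CurveHasGoodReduction ℤ_[p] (E.baseChange ℚ_[p])

/-- `#Ẽ_p(𝔽_p)` for a curve `E / ℚ` and a prime number `p`. -/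
def pointCountAt (E : WeierstrassCurve ℚ) (p : ℕ) [Fact p.Prime] : ℕ :=
  reductionPointCount ℤ_[p] (E.baseChange ℚ_[p])

section QuadraticField

variable {K : Type*} [Field K] [NumberField K]

/-- `#Ẽ_𝔭(𝔽_𝔭)` for a curve `E / ℚ`, base changed to `K`, and a prime `𝔭` of `K` with residue
field `𝔽_𝔭`. -/
def pointCountAtPrime (E : WeierstrassCurve ℚ) (P : HeightOneSpectrum (𝓞 K)) : ℕ :=
  reductionPointCount (P.adicCompletionIntegers K)
    ((E.baseChange K).baseChange (P.adicCompletion K))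

/-- `π` is the value at `𝔭` of the Grössencharacter `ψ_E` of a curve `E / ℚ` with complex
multiplication by `𝓞 K`, where `𝔭` is a prime of good reduction of residue characteristic at
least `5`: `π` generates `𝔭`, and `#Ẽ_𝔭(𝔽_𝔭) = N 𝔭 + 1 - Tr π`. -/
structure IsGrossencharacterValue (E : WeierstrassCurve ℚ) (P : HeightOneSpectrum (𝓞 K))
    (π : 𝓞 K) : Prop where
  span_eq : Ideal.span {π} = P.asIdeal
  pointCount_eq : (pointCountAtPrime E P : ℤ) =
    (Ideal.absNorm P.asIdeal : ℤ) + 1 - Algebra.trace ℤ (𝓞 K) π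

open Classical in
/-- The sextic residue symbol `(α / 𝔭)₆`: the sixth root of unity congruent to
`α ^ ((N 𝔭 - 1) / 6)` modulo `𝔭` (and `0` if there is none). -/
def sexticSymbol (α : 𝓞 K) (I : Ideal (𝓞 K)) : 𝓞 K :=
  if h : ∃ ζ : 𝓞 K, ζ ^ 6 = 1 ∧ ζ - α ^ ((Ideal.absNorm I - 1) / 6) ∈ I then h.choose else 0

end QuadraticField

end

/-! Good reduction forces k = p^(6a)·k₀ with p ∤ k₀, so the reduced curve is y² = x³ + k₀. If p ≡ 2
mod 3, cubing is bijective on 𝔽_p and the point count p + 1 is even, which a prime q ≥ 5 excludes.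
So p ≡ 1 mod 3, the residue field of 𝔭 is 𝔽_p, and there is a sextic character ψ lifting x ↦
x^((p-1)/6). Counting with χ = ψ² and η = ψ³ gives p - (π₀ + π̄₀) affine points, where π₀ =
-χ(-k₀)η(k₀)J(χ,η) generates 𝔭 (`IsSexticChar.exists_frobenius`). Any other admissible generator has
the same norm and trace, hence is π̄₀; then p would divide the trace, which
`not_dvd_trace_of_mod_six` rules out. (a) If ψ(k)² = 1 then 2 divides the point count; if ψ(k)³ = 1
then 3 does. Since the count is a prime q ≥ 5, ψ(k) is a primitive sixth root of unity. (b) The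
Jacobi sum J(χ,χ) generates 𝔭, is -1 mod 3, and is χ(2) mod 2; likewise at 𝔮. As p and q are 1 mod
6, so is π(1 - π). Comparison shows that the cubic symbols of 2 at 𝔭 and 𝔮 cancel
(`cubic_apply_two_mul_eq_one`). The product of the sextic symbols thus has square 1 and equals its
own cube, a product of Legendre symbols by Euler's criterion. -/

/-- The number of affine points of `y² = x³ + c`. -/
noncomputable def mordellCount (F : Type*) [Field F] (c : F) : ℕ :=
  Nat.card {P : F × F // P.2 ^ 2 = P.1 ^ 3 + c}

theorem mordellCount_congr {F F' : Type*} [Field F] [Field F'] (f : F ≃+* F') (c : F) :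
    mordellCount F' (f c) = mordellCount F c := by
  refine (Nat.card_congr ((f.toEquiv.prodCongr f.toEquiv).subtypeEquiv ?_)).symm
  rintro ⟨x, y⟩
  simp [← map_pow, ← map_add]

theorem mordellCount_mul_pow_six {F : Type*} [Field F] (c v : F) (hv : v ≠ 0) :
    mordellCount F (c * v ^ 6) = mordellCount F c := by
  refine (Nat.card_congr (((Equiv.mulRight₀ (v ^ 2) (pow_ne_zero 2 hv)).prodCongr
    (Equiv.mulRight₀ (v ^ 3) (pow_ne_zero 3 hv))).subtypeEquiv ?_)).symm
  rintro ⟨x, y⟩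
  have h6 : v ^ 6 ≠ 0 := pow_ne_zero 6 hv
  simp only [Equiv.prodCongr_apply, Prod.map, Equiv.mulRight₀_apply]
  constructor
  · intro h
    linear_combination v ^ 6 * h
  · intro h
    apply mul_left_cancel₀ h6
    linear_combination h

/-- The points of a Weierstrass curve with nonzero discriminant and `c₄ = 0`. -/
theorem card_point_eq_mordellCount {F : Type*} [Field F] [Finite F] (W : WeierstrassCurve F)
    (h2 : (2 : F) ≠ 0) (h3 : (3 : F) ≠ 0) (hΔ : W.Δ ≠ 0) (h4 : W.c₄ = 0) (e : F)
    (h6 : W.c₆ = -864 * e) :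
    Nat.card W.toAffine.Point = mordellCount F e + 1 := by
  have : W.IsElliptic := ⟨hΔ.isUnit⟩
  let f : W.toAffine.Point ≃ Option {P : F × F // W.toAffine.Equation P.1 P.2} :=
    { toFun := fun P => match P with
        | .zero => none
        | .some x y h => some ⟨(x, y), h.left⟩
      invFun := fun P => match P with
        | none => .zero
        | some P => .some P.1.1 P.1.2 ((W.toAffine.equation_iff_nonsingular).1 P.2)
      left_inv := by rintro (_ | _) <;> rfl
      right_inv := by rintro (_ | _) <;> rfl }
  rw [Nat.card_congr f, Finite.card_option, mordellCount]
  congr 1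
  -- Completing the square and the cube gives y² = x³ - (c₄/48)x - c₆/864, and here c₄ = 0, e =
  -- -c₆/864.
  refine Nat.card_congr (Equiv.subtypeEquiv
    { toFun := fun P => (P.1 + W.b₂ / 12, P.2 + (W.a₁ * P.1 + W.a₃) / 2)
      invFun := fun P => (P.1 - W.b₂ / 12,
        P.2 - (W.a₁ * (P.1 - W.b₂ / 12) + W.a₃) / 2)
      left_inv := fun P => by ext <;> simp
      right_inv := fun P => by ext <;> simp } ?_)
  rintro ⟨x, y⟩
  have h12 : (12 : F) ≠ 0 := by
    rw [show (12 : F) = 2 * 2 * 3 by norm_num]; simp [h2, h3]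
  have h864 : (1728 : F) ≠ 0 := by
    rw [show (1728 : F) = 12 * 12 * 12 by norm_num]; simp [h12]
  have he : 864 * e = - W.c₆ := by rw [h6]; ring
  have key : 1728 * ((y + (W.a₁ * x + W.a₃) / 2) ^ 2 - ((x + W.b₂ / 12) ^ 3 + e)) =
      1728 * (y ^ 2 + W.a₁ * x * y + W.a₃ * y - (x ^ 3 + W.a₂ * x ^ 2 + W.a₄ * x + W.a₆)) := by
    have : 1728 * ((y + (W.a₁ * x + W.a₃) / 2) ^ 2 - ((x + W.b₂ / 12) ^ 3 + e)) =
      1728 * ((y + (W.a₁ * x + W.a₃) / 2) ^ 2 - ((x + W.b₂ / 12) ^ 3)) + 2 * W.c₆ +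
        36 * x * W.c₄ + 3 * W.b₂ * W.c₄ := by
      rw [h4]; linear_combination (-2) * he
    rw [this]
    simp only [WeierstrassCurve.c₄, WeierstrassCurve.c₆, WeierstrassCurve.b₂,
      WeierstrassCurve.b₄, WeierstrassCurve.b₆]
    field_simp
    ring
  rw [WeierstrassCurve.Affine.equation_iff']
  simp only [Equiv.coe_fn_mk]
  constructor
  · intro h
    refine sub_eq_zero.1 (mul_left_cancel₀ h864 ?_)
    rw [key]; linear_combination 1728 * h
  · intro h
    refine (mul_left_cancel₀ h864 ?_)
    rw [← sub_eq_zero] at h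
    linear_combination 1728 * h - key

/-! ### Minimal models of y² = x³ + k over a discrete valuation ring -/

section LocalReduction

variable (R : Type*) [CommRing R] [IsDomain R] [IsDiscreteValuationRing R]
  {F : Type*} [Field F] [Algebra R F] [IsFractionRing R F]

open WeierstrassCurve IsLocalRing

theorem isUnit_discr_integralModel_iff (W : WeierstrassCurve F) [W.IsIntegral R] :
    IsUnit (W.integralModel R).Δ ↔
      (IsDiscreteValuationRing.maximalIdeal R).valuation F W.Δ = 1 := by
  rw [← integralModel_Δ_eq R W, HeightOneSpectrum.valuation_eq_one_iff_notMem]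
  simp [IsDiscreteValuationRing.maximalIdeal]

/-- Point count of the reduction of `y² = x³ + k` at a place of good reduction. -/
theorem exists_reductionPointCount_eq (h2 : (2 : ResidueField R) ≠ 0)
    (h3 : (3 : ResidueField R) ≠ 0) [Finite (ResidueField R)] (W : WeierstrassCurve F) (k : F)
    (hW : W = ⟨0, 0, 0, 0, k⟩) (hg : CurveHasGoodReduction R W) :
    ∃ (e : R) (u : F), IsUnit e ∧ u ≠ 0 ∧ algebraMap R F e = k * u ^ 6 ∧
      reductionPointCount R W = mordellCount (ResidueField R) (residue R e) + 1 := by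
  obtain ⟨C, hC⟩ : ∃ C : VariableChange F, W.minimal R = C • W := ⟨_, rfl⟩
  set M := W.minimal R with hM
  have hΔ : IsUnit (M.integralModel R).Δ :=
    (isUnit_discr_integralModel_iff R M).2 hg.goodReduction
  have hinj := IsFractionRing.injective R F
  have h4 : (M.integralModel R).c₄ = 0 := by
    apply hinj
    rw [integralModel_c₄_eq, hC, variableChange_c₄, hW]
    simp [WeierstrassCurve.c₄, WeierstrassCurve.b₂, WeierstrassCurve.b₄]
  have h2u : IsUnit (2 : R) := by
    by_contra h
    exact h2 (by rw [← map_ofNat (residue R) 2]; exact (residue_eq_zero_iff _).2 h)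
  have h3u : IsUnit (3 : R) := by
    by_contra h
    exact h3 (by rw [← map_ofNat (residue R) 3]; exact (residue_eq_zero_iff _).2 h)
  have h864 : IsUnit (864 : R) := by
    rw [show (864 : R) = 2 ^ 5 * 3 ^ 3 by norm_num]
    exact (h2u.pow 5).mul (h3u.pow 3)
  obtain ⟨i, hi⟩ := h864.exists_right_inv
  have h6 : (M.integralModel R).c₆ = -864 * (-(i * (M.integralModel R).c₆)) := by
    linear_combination (-(M.integralModel R).c₆) * hi
  set e : R := -(i * (M.integralModel R).c₆) with he
  -- With c₄ = 0 the relation 1728Δ = c₄³ - c₆² makes c₆, hence e, a unit.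
  have hrel := (M.integralModel R).c_relation
  rw [h4] at hrel
  refine ⟨e, ((C.u⁻¹ : Fˣ) : F), ?_, Units.ne_zero _, ?_, ?_⟩
  · have h : IsUnit ((e * -864) ^ 2) := by
      have : (e * -864) ^ 2 = -(2 ^ 6 * 3 ^ 3 * (M.integralModel R).Δ) := by
        rw [mul_comm, ← h6]; linear_combination hrel
      rw [this]
      exact (((h2u.pow 6).mul (h3u.pow 3)).mul hΔ).neg
    exact isUnit_of_mul_isUnit_left ((isUnit_pow_iff two_ne_zero).1 h)
  · have h := congr_arg (algebraMap R F) h6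
    rw [integralModel_c₆_eq, hC, variableChange_c₆, hW, map_mul, map_neg, map_ofNat] at h
    have h864F : (864 : F) ≠ 0 := by
      have := (h864.map (algebraMap R F)).ne_zero
      rwa [map_ofNat] at this
    apply mul_left_cancel₀ h864F
    simp [WeierstrassCurve.c₆, WeierstrassCurve.b₂, WeierstrassCurve.b₄,
      WeierstrassCurve.b₆] at h
    rw [Units.val_inv_eq_inv_val, inv_pow]
    linear_combination -h
  · rw [reductionPointCount]
    apply card_point_eq_mordellCount _ h2 h3
    · rw [WeierstrassCurve.reduction, map_Δ]
      exact (hΔ.map (residue R)).ne_zero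
    · rw [WeierstrassCurve.reduction, map_c₄, h4, map_zero]
    · rw [WeierstrassCurve.reduction, map_c₆, h6, map_mul, map_neg, map_ofNat]

/-- An integral model has discriminant of valuation at most 1, and the minimal model maximizes this
valuation among integral ones; if 1 is attained anywhere, it is attained there. -/
theorem curveHasGoodReduction_of_exists (W : WeierstrassCurve F) (C : VariableChange F)
    (h : (C • W).IsIntegral R)
    (hΔ : (IsDiscreteValuationRing.maximalIdeal R).valuation F (C • W).Δ = 1) :
    CurveHasGoodReduction R W := by
  obtain ⟨D, hD⟩ : ∃ D : VariableChange F, W.minimal R = D • W := ⟨_, rfl⟩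
  have hE : (C * D⁻¹) • W.minimal R = C • W := by rw [hD, smul_smul]; simp
  refine (hasGoodReduction_iff R (W.minimal R)).2 ⟨inferInstance, ?_⟩
  have hmax := (inferInstance : (W.minimal R).IsMinimal R).val_Δ_maximal
  have h1 := hmax.2 (show IsIntegral R ((C * D⁻¹) • W.minimal R) by rw [hE]; exact h)
  have hval : ((valuation_Δ_aux R ((C * D⁻¹) • W.minimal R)) : WithZero (Multiplicative ℤ)) = 1 := by
    rw [hE, valuation_Δ_aux_eq_of_isIntegral, hΔ]
  have hone : ((valuation_Δ_aux R ((1 : VariableChange F) • W.minimal R)) :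
      WithZero (Multiplicative ℤ)) = 
      (IsDiscreteValuationRing.maximalIdeal R).valuation F (W.minimal R).Δ := by
    rw [one_smul, valuation_Δ_aux_eq_of_isIntegral]
  have h2 := h1 (by
    rw [← Subtype.coe_le_coe, hval]
    exact (valuation_Δ_aux R ((1 : VariableChange F) • W.minimal R)).2)
  rw [← Subtype.coe_le_coe, hval, hone] at h2
  refine le_antisymm ?_ h2
  rw [← hone]
  exact (valuation_Δ_aux R ((1 : VariableChange F) • W.minimal R)).2

theorem curveHasGoodReduction_of_eq_mul_pow (h2 : (2 : ResidueField R) ≠ 0)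
    (h3 : (3 : ResidueField R) ≠ 0) (W : WeierstrassCurve F) (k v : F) (k₀ : R)
    (hW : W = ⟨0, 0, 0, 0, k⟩) (hk₀ : IsUnit k₀) (hv : v ≠ 0)
    (hk : k = algebraMap R F k₀ * v ^ 6) :
    CurveHasGoodReduction R W := by
  have hC : (⟨Units.mk0 v hv, 0, 0, 0⟩ : VariableChange F) • W =
      (⟨0, 0, 0, 0, k₀⟩ : WeierstrassCurve R).map (algebraMap R F) := by
    rw [hW, variableChange_def, hk]
    ext <;> simp
    field_simp
  refine curveHasGoodReduction_of_exists R W ⟨Units.mk0 v hv, 0, 0, 0⟩ ⟨_, hC⟩ ?_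
  rw [hC, map_Δ, HeightOneSpectrum.valuation_eq_one_iff_notMem]
  simp only [IsDiscreteValuationRing.maximalIdeal, mem_maximalIdeal, mem_nonunits_iff, not_not]
  have : (⟨0, 0, 0, 0, k₀⟩ : WeierstrassCurve R).Δ = -(2 ^ 4 * 3 ^ 3 * k₀ ^ 2) := by
    simp [WeierstrassCurve.Δ, WeierstrassCurve.b₂, WeierstrassCurve.b₄,
      WeierstrassCurve.b₆, WeierstrassCurve.b₈]
    ring
  rw [this]
  have h2u : IsUnit (2 : R) := by
    by_contra h
    exact h2 (by rw [← map_ofNat (residue R) 2]; exact (residue_eq_zero_iff _).2 h)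
  have h3u : IsUnit (3 : R) := by
    by_contra h
    exact h3 (by rw [← map_ofNat (residue R) 3]; exact (residue_eq_zero_iff _).2 h)
  exact (((h2u.pow 4).mul (h3u.pow 3)).mul (hk₀.pow 2)).neg

/-- The minimal model may yield a constant e other than k₀, but their ratio is a sixth power in F.
The sixth root is integral because R is integrally closed, and is then a unit, so it does not affect
the count. -/
theorem reductionPointCount_eq_of_eq_mul_pow (h2 : (2 : ResidueField R) ≠ 0)
    (h3 : (3 : ResidueField R) ≠ 0) [Finite (ResidueField R)]
    (W : WeierstrassCurve F) (k v : F) (k₀ : R)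
    (hW : W = ⟨0, 0, 0, 0, k⟩) (hk₀ : IsUnit k₀) (hv : v ≠ 0)
    (hk : k = algebraMap R F k₀ * v ^ 6) :
    reductionPointCount R W = mordellCount (ResidueField R) (residue R k₀) + 1 := by
  obtain ⟨e, u, he, hu, heq, hcount⟩ := exists_reductionPointCount_eq R h2 h3 W k hW
    (curveHasGoodReduction_of_eq_mul_pow R h2 h3 W k v k₀ hW hk₀ hv hk)
  rw [hcount]
  congr 1
  obtain ⟨j, hj⟩ := hk₀.exists_right_inv
  have hpow : (v * u) ^ 6 = algebraMap R F (e * j) := by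
    rw [map_mul, heq, hk]
    have := congr_arg (algebraMap R F) hj
    rw [map_mul, map_one] at this
    linear_combination (-(v * u) ^ 6) * this
  obtain ⟨w, hw⟩ := IsIntegrallyClosed.exists_algebraMap_eq_of_isIntegral_pow (R := R)
    (K := F) (x := v * u) (n := 6) (by norm_num) (by rw [hpow]; exact isIntegral_algebraMap)
  have hinj := IsFractionRing.injective R F
  have he' : e = k₀ * w ^ 6 := by
    apply hinj
    rw [map_mul, map_pow, hw, heq, hk]; ring
  have hwu : IsUnit w := (isUnit_pow_iff (n := 6) (by norm_num)).1
    (isUnit_of_mul_isUnit_right (he' ▸ he))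
  rw [he', map_mul, map_pow]
  exact mordellCount_mul_pow_six _ _ (hwu.map (residue R)).ne_zero

end LocalReduction

/-! ### Residue field of a completion -/

section Completion

open HeightOneSpectrum IsLocalRing

variable {R : Type*} [CommRing R] [IsDedekindDomain R] (K : Type*) [Field K] [Algebra R K]
  [IsFractionRing R K] (v : HeightOneSpectrum R)

theorem residue_adicCompletionIntegers_eq_zero_iff (x : v.adicCompletionIntegers K) :
    residue (v.adicCompletionIntegers K) x = 0 ↔ Valued.v (x : v.adicCompletion K) < 1 := by
  rw [residue_eq_zero_iff, mem_maximalIdeal, mem_nonunits_iff,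
    adicCompletionIntegers.isUnit_iff_valued_eq_one]
  have := x.2
  rw [mem_adicCompletionIntegers] at this
  exact ⟨fun h => lt_of_le_of_ne this h, fun h => h.ne⟩

theorem residue_comp_algebraMap_surjective :
    Function.Surjective ((residue (v.adicCompletionIntegers K)).comp
      (algebraMap R (v.adicCompletionIntegers K))) := by
  intro y
  obtain ⟨x, rfl⟩ := residue_surjective y
  have hopen : IsOpen {z : v.adicCompletion K | Valued.v (z - x) < 1} := by
    have h1 := (Valued.isOpen_ball (v.adicCompletion K) 1).preimage
      (continuous_sub_right (x : v.adicCompletion K))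
    convert h1 using 1
    ext z
    simp
  -- Two approximations: the completion by K, then an integral element of K by R.
  obtain ⟨k, hk⟩ := (denseRange_algebraMap (R := R) K v).exists_mem_open hopen
    ⟨x, by simp⟩
  have hx := x.2
  rw [mem_adicCompletionIntegers] at hx
  have hkv : v.valuation K k ≤ 1 := by
    rw [← valuedAdicCompletion_eq_valuation']
    have : (k : v.adicCompletion K) = (k - x) + x := by ring
    rw [this]
    exact (Valuation.map_add_le _ hk.le hx)
  obtain ⟨a, ha⟩ := exists_valuation_sub_lt_of_integer (K := K) v hkv 1
  refine ⟨a, ?_⟩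
  rw [RingHom.comp_apply, ← sub_eq_zero, ← map_sub, residue_adicCompletionIntegers_eq_zero_iff]
  have : (((algebraMap R (v.adicCompletionIntegers K) a - x : v.adicCompletionIntegers K)) :
      v.adicCompletion K) = ((algebraMap R K a - k : K) : v.adicCompletion K) + (k - x) := by
    push_cast
    rw [algebraMap_adicCompletionIntegers_apply]
    have h2 : ((algebraMap R K a - k : K) : v.adicCompletion K) =
      (algebraMap R K a : v.adicCompletion K) - k := map_sub (algebraMap K (v.adicCompletion K)) _ _
    rw [h2]
    ring
  rw [this]
  refine Valuation.map_add_lt _ ?_ hk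
  rw [valuedAdicCompletion_eq_valuation']
  simpa using ha

theorem ker_residue_comp_algebraMap :
    RingHom.ker ((residue (v.adicCompletionIntegers K)).comp
      (algebraMap R (v.adicCompletionIntegers K))) = v.asIdeal := by
  ext a
  rw [RingHom.mem_ker, RingHom.comp_apply, residue_adicCompletionIntegers_eq_zero_iff,
    algebraMap_adicCompletionIntegers_apply, valuedAdicCompletion_eq_valuation',
    valuation_lt_one_iff_mem]

/-- The residue field of the completion at `v` is the residue field of `v`. -/
noncomputable def quotientEquivResidueField :
    R ⧸ v.asIdeal ≃+* ResidueField (v.adicCompletionIntegers K) :=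
  (Ideal.quotEquivOfEq (ker_residue_comp_algebraMap K v).symm).trans
    (RingHom.quotientKerEquivOfSurjective (residue_comp_algebraMap_surjective K v))

end Completion

/-! ### Point counts at p and at 𝔭 -/

section PointCounts

open IsLocalRing

theorem natCast_ne_zero_of_lt_prime {F : Type*} [Field F] {p : ℕ} (hp : p.Prime)
    (hF : (p : F) = 0) {n : ℕ} (hn : n ≠ 0) (hlt : n < p) : (n : F) ≠ 0 := by
  have : CharP F p := by
    have := Fact.mk hp
    exact (CharP.charP_iff_prime_eq_zero hp).2 hF
  rw [Ne, CharP.cast_eq_zero_iff F p]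
  exact Nat.not_dvd_of_pos_of_lt (Nat.pos_of_ne_zero hn) hlt

/-- Good reduction makes k·u⁶ a p-adic unit for some u, so 6 divides the valuation of k. -/
theorem exists_eq_pow_six_mul_of_goodReductionAt {k : ℤ} (hk : k ≠ 0) {p : ℕ} [hpp : Fact p.Prime]
    (hp : 5 ≤ p) (hg : GoodReductionAt (mordellCurve k) p) :
    ∃ (a : ℕ) (k₀ : ℤ), ¬ (p : ℤ) ∣ k₀ ∧ k = p ^ (6 * a) * k₀ := by
  have hF : (p : ResidueField ℤ_[p]) = 0 :=
    (PadicInt.residueField (p := p)).injective (by simp)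
  have : Finite (ResidueField ℤ_[p]) := Finite.of_equiv _ (PadicInt.residueField (p := p)).toEquiv.symm
  have h2 := natCast_ne_zero_of_lt_prime hpp.out hF two_ne_zero (by omega)
  have h3 := natCast_ne_zero_of_lt_prime hpp.out hF three_ne_zero (by omega)
  push_cast at h2 h3
  obtain ⟨e, u, he, hu, heq, -⟩ := exists_reductionPointCount_eq ℤ_[p] h2 h3
    ((mordellCurve k).baseChange ℚ_[p]) (k : ℚ_[p])
    (by ext <;> simp [mordellCurve, WeierstrassCurve.baseChange]) hg
  have hval : (padicValInt p k : ℤ) = -6 * u.valuation := by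
    have hkp : (k : ℚ_[p]) ≠ 0 := by exact_mod_cast hk
    have := congr_arg Padic.valuation heq
    rw [Padic.valuation_mul hkp (pow_ne_zero _ hu), Padic.valuation_pow,
      Padic.valuation_intCast] at this
    have h0 : (algebraMap ℤ_[p] ℚ_[p] e).valuation = 0 := by
      have := PadicInt.isUnit_iff.1 he
      have h1 : (e : ℚ_[p]) ≠ 0 := by
        intro h
        have h3 : ‖(e : ℚ_[p])‖ = 1 := this
        rw [h] at h3; simp at h3
      have h2 := Padic.norm_eq_zpow_neg_valuation h1
      change ‖(e : ℚ_[p])‖ = 1 at this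
      rw [this] at h2
      have h3 := (zpow_eq_one_iff_right₀ (a := (p : ℝ)) (by positivity) (by
        have := hpp.out.one_lt
        exact_mod_cast this.ne')).1 h2.symm
      simpa using h3
    rw [h0] at this
    push_cast at this
    linarith
  obtain ⟨a, ha⟩ : ∃ a : ℕ, padicValInt p k = 6 * a := ⟨padicValInt p k / 6, by omega⟩
  obtain ⟨k₀, hk₀⟩ : (p : ℤ) ^ (6 * a) ∣ k := (padicValInt_dvd_iff _ _).2 (Or.inr ha.ge)
  refine ⟨a, k₀, fun ⟨l, hl⟩ => ?_, hk₀⟩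
  have : (p : ℤ) ^ (6 * a + 1) ∣ k := ⟨l, by rw [hk₀, hl]; ring⟩
  rcases (padicValInt_dvd_iff _ _).1 this with h | h
  · exact hk h
  · omega

theorem pointCountAt_mordellCurve {k k₀ : ℤ} {p a : ℕ} [hpp : Fact p.Prime]
    (hp : 5 ≤ p) (hk₀ : ¬ (p : ℤ) ∣ k₀) (hk : k = p ^ (6 * a) * k₀) :
    pointCountAt (mordellCurve k) p = mordellCount (ZMod p) k₀ + 1 := by
  have hF : (p : ResidueField ℤ_[p]) = 0 :=
    (PadicInt.residueField (p := p)).injective (by simp)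
  have : Finite (ResidueField ℤ_[p]) := Finite.of_equiv _ (PadicInt.residueField (p := p)).toEquiv.symm
  have h2 := natCast_ne_zero_of_lt_prime hpp.out hF two_ne_zero (by omega)
  have h3 := natCast_ne_zero_of_lt_prime hpp.out hF three_ne_zero (by omega)
  push_cast at h2 h3
  have hpk : IsUnit (k₀ : ℤ_[p]) := by
    rw [PadicInt.isUnit_iff]
    refine le_antisymm (PadicInt.norm_le_one _) (not_lt.1 fun h => hk₀ ?_)
    exact (PadicInt.norm_int_lt_one_iff_dvd k₀).1 h
  rw [pointCountAt, reductionPointCount_eq_of_eq_mul_pow ℤ_[p] h2 h3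
    ((mordellCurve k).baseChange ℚ_[p]) (k : ℚ_[p]) ((p : ℚ_[p]) ^ a) k₀
    (by ext <;> simp [mordellCurve, WeierstrassCurve.baseChange]) hpk
    (pow_ne_zero _ (by exact_mod_cast hpp.out.ne_zero)) (by rw [hk]; push_cast; simp; ring)]
  rw [← mordellCount_congr (PadicInt.residueField (p := p))]
  simp

theorem pointCountAtPrime_mordellCurve {K : Type*} [Field K] [NumberField K] {k k₀ : ℤ} {p a : ℕ}
    [hpp : Fact p.Prime] (hp : 5 ≤ p) (hk₀ : ¬ (p : ℤ) ∣ k₀) (hk : k = p ^ (6 * a) * k₀)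
    (P : HeightOneSpectrum (𝓞 K)) (f : 𝓞 K →+* ZMod p) (hf : RingHom.ker f = P.asIdeal) :
    pointCountAtPrime (mordellCurve k) P = mordellCount (ZMod p) k₀ + 1 := by
  let g : ResidueField (P.adicCompletionIntegers K) ≃+* ZMod p :=
    (quotientEquivResidueField K P).symm.trans ((Ideal.quotEquivOfEq hf.symm).trans
      (RingHom.quotientKerEquivOfSurjective (ZMod.ringHom_surjective f)))
  have hF : (p : ResidueField (P.adicCompletionIntegers K)) = 0 := g.injective (by simp)
  have : Finite (ResidueField (P.adicCompletionIntegers K)) := Finite.of_equiv _ g.toEquiv.symm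
  have h2 := natCast_ne_zero_of_lt_prime hpp.out hF two_ne_zero (by omega)
  have h3 := natCast_ne_zero_of_lt_prime hpp.out hF three_ne_zero (by omega)
  push_cast at h2 h3
  have hpk : IsUnit (k₀ : P.adicCompletionIntegers K) := by
    by_contra h
    have h1 := (residue_eq_zero_iff _).2 h
    have h2 := congr_arg g h1
    rw [map_intCast, map_intCast, map_zero] at h2
    exact hk₀ ((ZMod.intCast_zmod_eq_zero_iff_dvd _ _).1 h2)
  have hp0 : (p : P.adicCompletion K) ≠ 0 := by
    rw [← map_natCast (algebraMap K (P.adicCompletion K)), Ne,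
      map_eq_zero_iff _ (algebraMap K (P.adicCompletion K)).injective]
    exact_mod_cast hpp.out.ne_zero
  rw [pointCountAtPrime, reductionPointCount_eq_of_eq_mul_pow (P.adicCompletionIntegers K) h2 h3
    (((mordellCurve k).baseChange K).baseChange (P.adicCompletion K)) (k : P.adicCompletion K)
    ((p : P.adicCompletion K) ^ a) k₀
    (by ext <;> simp [mordellCurve, WeierstrassCurve.baseChange]) hpk
    (pow_ne_zero _ hp0) (by rw [hk]; push_cast; simp; ring)]
  rw [← mordellCount_congr g]
  simp

end PointCounts

/-! ### Jacobi sums -/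

section CharacterSums

/-- Each monomial has degree below #F - 1, so its sum over F vanishes. -/
theorem sum_pow_mul_one_sub_pow_eq_zero {F : Type*} [Field F] [Fintype F] (a b : ℕ)
    (h : a + b < Fintype.card F - 1) : ∑ x : F, x ^ a * (1 - x) ^ b = 0 := by
  have (x : F) : x ^ a * (1 - x) ^ b =
      ∑ i ∈ Finset.range (b + 1), (-1) ^ (b - i) * (b.choose i : F) * x ^ (a + (b - i)) := by
    rw [sub_eq_add_neg, add_pow, Finset.mul_sum]
    refine Finset.sum_congr rfl fun i _ => ?_
    rw [neg_pow, pow_add]; ring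
  simp_rw [this]
  rw [Finset.sum_comm]
  refine Finset.sum_eq_zero fun i _ => ?_
  rw [← Finset.mul_sum, FiniteField.sum_pow_lt_card_sub_one F _ (by omega), mul_zero]

theorem jacobiSum_mul_jacobiSum_inv_of_charZero {F O : Type*} [Field F] [Fintype F]
    [CommRing O] [IsDomain O] [CharZero O] {χ φ : MulChar F O} (hχ : χ ≠ 1) (hφ : φ ≠ 1)
    (hχφ : χ * φ ≠ 1) :
    jacobiSum χ φ * jacobiSum χ⁻¹ φ⁻¹ = Fintype.card F := by
  have hinj := IsFractionRing.injective O (FractionRing O)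
  have : CharZero (FractionRing O) := charZero_of_injective_algebraMap hinj
  apply hinj
  rw [map_mul, ← jacobiSum_ringHomComp, ← jacobiSum_ringHomComp, ← MulChar.ringHomComp_inv,
    ← MulChar.ringHomComp_inv, jacobiSum_mul_jacobiSum_inv, map_natCast]
  · rw [ringChar.eq_zero]
    exact fun h => CharP.ringChar_ne_zero_of_finite F h.symm
  · exact (MulChar.ringHomComp_ne_one_iff hinj).mpr hχ
  · exact (MulChar.ringHomComp_ne_one_iff hinj).mpr hφ
  · rw [← MulChar.ringHomComp_mul]
    exact (MulChar.ringHomComp_ne_one_iff hinj).mpr hχφ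

theorem sum_mul_apply_add_eq_jacobiSum {F O : Type*} [Field F] [Fintype F] [CommRing O]
    (χ φ : MulChar F O) {c : F} (hc : c ≠ 0) :
    ∑ b : F, χ b * φ (b + c) = χ (-c) * φ c * jacobiSum χ φ := by
  rw [jacobiSum, Finset.mul_sum]
  refine (Fintype.sum_equiv (Equiv.mulRight₀ (-c) (neg_ne_zero.2 hc)) _ _ fun x => ?_).symm
  rw [Equiv.mulRight₀_apply, map_mul, show x * -c + c = (1 - x) * c by ring, map_mul]
  ring

/-- Pairing `x` with `1 - x`, the Jacobi sum of a cubic character is `χ 2` modulo `2`. -/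
theorem two_dvd_jacobiSum_sub {F O : Type*} [Field F] [Fintype F] [CommRing O]
    (h2 : (2 : F) ≠ 0) (χ : MulChar F O) (hχ : χ ^ 3 = 1) :
    (2 : O) ∣ jacobiSum χ χ - χ 2 := by
  classical
  -- The fixed point 1/2 of x ↦ 1 - x contributes χ(2)⁻², which is χ(2) for cubic χ.
  have hval : χ 2⁻¹ * χ (1 - 2⁻¹) = χ 2 := by
    have h4 : (1 - 2⁻¹ : F) = 2⁻¹ := by field_simp; norm_num
    have h3 : χ 2 ^ 3 = 1 := by
      rw [← MulChar.pow_apply' _ three_ne_zero, hχ, MulChar.one_apply h2.isUnit]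
    have h1 : χ 2 * χ 2⁻¹ = 1 := by rw [← map_mul, mul_inv_cancel₀ h2, map_one]
    rw [h4]
    calc χ 2⁻¹ * χ 2⁻¹ = χ 2 ^ 3 * (χ 2⁻¹ * χ 2⁻¹) := by rw [h3, one_mul]
      _ = (χ 2 * χ 2⁻¹) ^ 2 * χ 2 := by ring
      _ = χ 2 := by rw [h1]; ring
  rw [← Ideal.mem_span_singleton, ← Ideal.Quotient.eq_zero_iff_mem, map_sub, jacobiSum,
    ← Finset.add_sum_erase _ _ (Finset.mem_univ (2⁻¹ : F)), hval, map_add, add_sub_cancel_left,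
    map_sum]
  refine Finset.sum_involution (fun x _ => 1 - x) ?_ ?_ ?_ ?_
  · intro x _
    rw [sub_sub_cancel, mul_comm (χ (1 - x)), ← map_add, Ideal.Quotient.eq_zero_iff_mem,
      Ideal.mem_span_singleton]
    exact ⟨_, (two_mul _).symm⟩
  · intro x hx _ h
    refine Finset.ne_of_mem_erase hx ?_
    rw [eq_comm, inv_eq_iff_eq_inv]
    refine eq_inv_of_mul_eq_one_left ?_
    linear_combination -h
  · intro x hx
    refine Finset.mem_erase.2 ⟨fun h => Finset.ne_of_mem_erase hx ?_, Finset.mem_univ _⟩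
    have : x = 1 - 2⁻¹ := by rw [← h]; ring
    rw [this]; field_simp; norm_num
  · intro x _
    ring

end CharacterSums

/-! ### The sextic residue character -/

section SexticCharacter

variable {O : Type*} [CommRing O] {ω : O} (hω : IsPrimitiveRoot ω 6)
  {p : ℕ} [hpp : Fact p.Prime] (hp : 5 ≤ p) (f : O →+* ZMod p)

theorem six_ne_zero_zmod (hp : 5 ≤ p) : (6 : ZMod p) ≠ 0 := by
  have h2 := natCast_ne_zero_of_lt_prime hpp.out (CharP.cast_eq_zero (ZMod p) p) two_ne_zero
    (by omega)
  have h3 := natCast_ne_zero_of_lt_prime hpp.out (CharP.cast_eq_zero (ZMod p) p) three_ne_zero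
    (by omega)
  push_cast at h2 h3
  rw [show (6 : ZMod p) = 2 * 3 by norm_num]
  exact mul_ne_zero h2 h3

/-- The character of `𝔽_p` with values in the sixth roots of unity which lifts
`x ↦ x ^ ((p - 1) / 6)`. -/
structure IsSexticChar (ψ : MulChar (ZMod p) O) : Prop where
  pow_six_eq_one : ψ ^ 6 = 1
  map_apply : ∀ x, f (ψ x) = x ^ ((p - 1) / 6)

theorem IsSexticChar.apply_pow_six {f : O →+* ZMod p} {ψ : MulChar (ZMod p) O}
    (hψ : IsSexticChar f ψ) {x : ZMod p} (hx : x ≠ 0) : ψ x ^ 6 = 1 := by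
  rw [← MulChar.pow_apply' _ (by norm_num), hψ.pow_six_eq_one, MulChar.one_apply hx.isUnit]

include hp in
-- X⁶ - 1 is separable mod p: two distinct sixth roots of unity with equal image would give 6y⁵ = 0
-- in 𝔽_p.
theorem eq_of_pow_six_eq_one [IsDomain O] {x y : O} (hx : x ^ 6 = 1) (hy : y ^ 6 = 1) (h : f x = f y) :
    x = y := by
  by_contra hne
  have h0 : (x - y) * (x ^ 5 + x ^ 4 * y + x ^ 3 * y ^ 2 + x ^ 2 * y ^ 3 + x * y ^ 4 + y ^ 5)
      = 0 := by
    linear_combination hx - hy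
  have h1 := congr_arg f ((mul_eq_zero.1 h0).resolve_left (sub_ne_zero.2 hne))
  simp only [map_add, map_mul, map_pow, h, map_zero] at h1
  have h2 : (6 : ZMod p) * f y ^ 5 = 0 := by linear_combination h1
  have h3 : f y ≠ 0 := by
    intro h3
    have := congr_arg f hy
    rw [map_pow, h3] at this
    simp at this
  exact mul_ne_zero (six_ne_zero_zmod hp) (pow_ne_zero 5 h3) h2

variable [IsDomain O]

include hω hp in
theorem isPrimitiveRoot_map_six : IsPrimitiveRoot (f ω) 6 := by
  refine ⟨by rw [← map_pow, hω.pow_eq_one, map_one], fun l hl => hω.dvd_of_pow_eq_one l ?_⟩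
  refine eq_of_pow_six_eq_one hp f ?_ (one_pow 6) (by rw [map_pow, hl, map_one])
  rw [pow_right_comm, hω.pow_eq_one, one_pow]

include hω hp f in
theorem six_dvd_sub_one : 6 ∣ p - 1 := by
  have h := isPrimitiveRoot_map_six hω hp f
  exact h.dvd_of_pow_eq_one _ (ZMod.pow_card_sub_one_eq_one (h.ne_zero (by norm_num)))

include hω hp in
theorem exists_isSexticChar : ∃ ψ : MulChar (ZMod p) O, IsSexticChar f ψ := by
  classical
  have h6 := six_dvd_sub_one hω hp f
  have hroot := isPrimitiveRoot_map_six hω hp f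
  have hex (x : (ZMod p)ˣ) : ∃ z : O, z ^ 6 = 1 ∧ f z = (x : ZMod p) ^ ((p - 1) / 6) := by
    have hx : ((x : ZMod p) ^ ((p - 1) / 6)) ^ 6 = 1 := by
      rw [← pow_mul, Nat.div_mul_cancel h6, ZMod.pow_card_sub_one_eq_one x.ne_zero]
    obtain ⟨i, -, hi⟩ := hroot.eq_pow_of_pow_eq_one hx
    exact ⟨ω ^ i, by rw [pow_right_comm, hω.pow_eq_one, one_pow], by rw [map_pow, hi]⟩
  choose g hg1 hg2 using hex
  let φ : (ZMod p)ˣ →* O :=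
    { toFun := g
      map_one' := eq_of_pow_six_eq_one hp f (hg1 1) (one_pow 6) (by rw [hg2]; simp)
      map_mul' := fun x y => eq_of_pow_six_eq_one hp f (hg1 _)
        (by rw [mul_pow, hg1, hg1, one_mul]) (by rw [map_mul, hg2, hg2, hg2]; simp [mul_pow]) }
  have hψ (x : (ZMod p)ˣ) : MulChar.ofUnitHom φ.toHomUnits x = g x := by
    rw [MulChar.ofUnitHom_coe]; rfl
  refine ⟨MulChar.ofUnitHom φ.toHomUnits, ?_, fun x => ?_⟩
  · ext x
    rw [MulChar.pow_apply_coe, hψ, hg1, MulChar.one_apply_coe]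
  · by_cases hx : x = 0
    · rw [hx, MulChar.map_zero, map_zero, zero_pow]
      have := hpp.out.two_le
      have : 0 < p - 1 := by omega
      exact (Nat.div_pos (Nat.le_of_dvd this h6) (by norm_num)).ne'
    · obtain ⟨u, rfl⟩ : IsUnit x := Ne.isUnit hx
      rw [hψ, hg2]

variable {f} {ψ : MulChar (ZMod p) O} (hψ : IsSexticChar f ψ)

include hψ hp hω in
theorem IsSexticChar.pow_three_eq :
    ψ ^ 3 = (quadraticChar (ZMod p)).ringHomComp (Int.castRingHom O) := by
  ext x
  have hx := x.ne_zero
  have h6 := six_dvd_sub_one hω hp f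
  refine eq_of_pow_six_eq_one hp f ?_ ?_ ?_
  · rw [MulChar.pow_apply' _ (by norm_num), pow_right_comm, hψ.apply_pow_six hx, one_pow]
  · rcases quadraticChar_dichotomy hx with h | h <;>
      simp [MulChar.ringHomComp_apply, h, Even.neg_one_pow (show Even 6 by decide)]
  · rw [MulChar.pow_apply' _ (by norm_num), map_pow, hψ.map_apply, ← pow_mul,
      MulChar.ringHomComp_apply]
    have hc : ringChar (ZMod p) ≠ 2 := by rw [ZMod.ringChar_zmod_n]; omega
    have h := quadraticChar_eq_pow_of_char_ne_two' hc (x : ZMod p)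
    rw [ZMod.card] at h
    rw [eq_intCast, map_intCast, h]
    congr 1
    omega

include hψ hp hω in
theorem IsSexticChar.pow_three_ne_one [CharZero O] : ψ ^ 3 ≠ 1 := by
  rw [hψ.pow_three_eq hω hp]
  exact (MulChar.ringHomComp_ne_one_iff (Int.castRingHom O).injective_int).2
    (quadraticChar_ne_one (by rw [ZMod.ringChar_zmod_n]; omega))

include hψ hp hω in
theorem IsSexticChar.exists_pow_three_eq {b : ZMod p} (hb : b ≠ 0) (h : ψ b ^ 2 = 1) :
    ∃ c, c ^ 3 = b := by
  have h6 := six_dvd_sub_one hω hp f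
  have hp1 : 0 < p - 1 := by omega
  have h1 : b ^ ((p - 1) / 3) = 1 := by
    have := congr_arg f h
    rw [map_pow, hψ.map_apply, ← pow_mul, map_one] at this
    convert this using 2
    omega
  obtain ⟨g, hg⟩ := IsCyclic.exists_generator (α := (ZMod p)ˣ)
  obtain ⟨n, hn⟩ := (mem_powers_iff_mem_zpowers).2 (hg (Units.mk0 b hb))
  have ho : orderOf g = p - 1 := by
    rw [orderOf_eq_card_of_forall_mem_zpowers hg, Nat.card_eq_fintype_card, ZMod.card_units]
  have h2 : g ^ (n * ((p - 1) / 3)) = 1 := by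
    rw [pow_mul]
    change (fun x => g ^ x) n ^ _ = 1
    rw [hn]
    ext
    simpa using h1
  have h3 := orderOf_dvd_of_pow_eq_one h2
  rw [ho] at h3
  obtain ⟨m, hm⟩ : 3 ∣ n := by
    obtain ⟨d, hd⟩ := h6
    have : (p - 1) / 3 = 2 * d := by omega
    rw [this, hd] at h3
    have hd0 : 0 < 2 * d := by omega
    refine Nat.dvd_of_mul_dvd_mul_right hd0 ?_
    convert h3 using 1; ring
  refine ⟨(g ^ m : (ZMod p)ˣ), ?_⟩
  have : (g ^ n : (ZMod p)ˣ) = Units.mk0 b hb := hn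
  rw [← Units.val_pow_eq_pow_val, ← pow_mul, mul_comm, ← hm, this, Units.val_mk0]

include hψ hp hω in
theorem IsSexticChar.pow_two_ne_one : ψ ^ 2 ≠ 1 := by
  intro h
  have h6 := six_dvd_sub_one hω hp f
  obtain ⟨g, hg⟩ := IsCyclic.exists_generator (α := (ZMod p)ˣ)
  have ho : orderOf g = p - 1 := by
    rw [orderOf_eq_card_of_forall_mem_zpowers hg, Nat.card_eq_fintype_card, ZMod.card_units]
  have h1 : ψ g ^ 2 = 1 := by
    rw [← MulChar.pow_apply' _ two_ne_zero, h, MulChar.one_apply g.isUnit]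
  have h2 := congr_arg f h1
  rw [map_pow, hψ.map_apply, ← pow_mul, map_one] at h2
  have h3 : p - 1 ∣ (p - 1) / 6 * 2 := by
    rw [← ho]
    refine orderOf_dvd_of_pow_eq_one ?_
    ext
    rw [ho]
    simpa using h2
  have := Nat.le_of_dvd (by omega) h3
  omega

include hψ hp hω in
-- Orthogonality for the cubic character ψ²: a nonzero non-cube has ψ(b)² a primitive cube root of
-- unity, and a nonzero cube has three roots because 𝔽_p contains f(ω)².
theorem IsSexticChar.card_cube_roots (b : ZMod p) :
    ((Finset.univ.filter fun x : ZMod p => x ^ 3 = b).card : O) = 1 + ψ b ^ 2 + (ψ b ^ 2) ^ 2 := by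
  classical
  by_cases hb : b = 0
  · have : (Finset.univ.filter fun x : ZMod p => x ^ 3 = b) = {0} := by
      ext x; simp [hb]
    rw [this, hb, MulChar.map_zero]; simp
  by_cases h1 : ψ b ^ 2 = 1
  · obtain ⟨c, rfl⟩ := hψ.exists_pow_three_eq hω hp hb h1
    have hr : IsPrimitiveRoot (f ω ^ 2) 3 :=
      (isPrimitiveRoot_map_six hω hp f).pow (by norm_num) (by norm_num)
    have hc0 : c ≠ 0 := by rintro rfl; simp at hb
    have hc : (Finset.univ.filter fun x : ZMod p => x ^ 3 = c ^ 3) =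
        (Polynomial.nthRootsFinset 3 (1 : ZMod p)).image (c * ·) := by
      ext x
      simp only [Finset.mem_filter, Finset.mem_univ, true_and, Finset.mem_image,
        Polynomial.mem_nthRootsFinset (Nat.succ_pos 2)]
      constructor
      · intro h
        refine ⟨x / c, ?_, mul_div_cancel₀ _ hc0⟩
        rw [div_pow, h, div_self (pow_ne_zero 3 hc0)]
      · rintro ⟨y, hy, rfl⟩
        rw [mul_pow, hy, mul_one]
    rw [hc, Finset.card_image_of_injective _ (mul_right_injective₀ hc0), hr.card_nthRootsFinset, h1]
    norm_num
  · have hS : (Finset.univ.filter fun x : ZMod p => x ^ 3 = b) = ∅ := by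
      ext x
      simp only [Finset.mem_filter, Finset.mem_univ, true_and, Finset.notMem_empty, iff_false]
      rintro rfl
      refine h1 ?_
      have hx : x ≠ 0 := by rintro rfl; simp at hb
      rw [map_pow, ← pow_mul]
      exact hψ.apply_pow_six hx
    have h3 : (ψ b ^ 2 - 1) * (1 + ψ b ^ 2 + (ψ b ^ 2) ^ 2) = 0 := by
      linear_combination hψ.apply_pow_six hb
    rw [hS, (mul_eq_zero.1 h3).resolve_left (sub_ne_zero.2 h1)]
    simp

end SexticCharacter

/-! ### Elementary counting on y² = x³ + c -/

section MordellCount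

variable {F : Type*} [Field F] [Fintype F] [DecidableEq F]

theorem mordellCount_eq_sum_sqrts (c : F) :
    mordellCount F c = ∑ x : F, (Finset.univ.filter fun y : F => y ^ 2 = x ^ 3 + c).card := by
  rw [mordellCount, Nat.card_eq_fintype_card, Fintype.card_subtype, Finset.card_filter,
    Fintype.sum_prod_type]
  simp_rw [Finset.card_filter]

theorem mordellCount_eq_sum_cube_roots (c : F) :
    mordellCount F c = ∑ y : F, (Finset.univ.filter fun x : F => x ^ 3 = y ^ 2 - c).card := by
  rw [mordellCount_eq_sum_sqrts]
  simp_rw [Finset.card_filter]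
  rw [Finset.sum_comm]
  refine Finset.sum_congr rfl fun y _ => Finset.sum_congr rfl fun x _ => ?_
  refine if_congr ?_ rfl rfl
  rw [eq_sub_iff_add_eq, eq_comm]

theorem mordellCount_eq_sum_quadraticChar (hF : ringChar F ≠ 2) (c : F) :
    (mordellCount F c : ℤ) = ∑ x : F, (quadraticChar F (x ^ 3 + c) + 1) := by
  rw [mordellCount_eq_sum_sqrts, Nat.cast_sum]
  refine Finset.sum_congr rfl fun x _ => ?_
  rw [← quadraticChar_card_sqrts hF]
  congr 2
  ext y; simp

theorem mordellCount_le (hF : ringChar F ≠ 2) (c : F) :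
    mordellCount F c ≤ 2 * Fintype.card F := by
  have h : (mordellCount F c : ℤ) ≤ ∑ x : F, 2 := by
    rw [mordellCount_eq_sum_quadraticChar hF]
    refine Finset.sum_le_sum fun x _ => ?_
    by_cases h0 : x ^ 3 + c = 0
    · simp [h0]
    · rcases quadraticChar_dichotomy h0 with h | h <;> simp [h]
  simp at h
  zify
  linarith

theorem mordellCount_eq_card (hF : 3 ∣ 2 * Fintype.card F - 1) (c : F) :
    mordellCount F c = Fintype.card F := by
  have hinj : Function.Injective fun x : F => x ^ 3 := by
    obtain ⟨m, hm⟩ := hF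
    -- Since 3m = 2(#F - 1) + 1, raising to the power m inverts cubing.
    have hpow (x : F) : (x ^ 3) ^ m = x := by
      have hpos : 0 < Fintype.card F := Fintype.card_pos
      by_cases hx : x = 0
      · have : m ≠ 0 := by omega
        simp [hx, this]
      · have h2 : 3 * m = (Fintype.card F - 1) * 2 + 1 := by omega
        rw [← pow_mul, h2, pow_add, pow_mul, FiniteField.pow_card_sub_one_eq_one x hx, one_pow,
          one_mul, pow_one]
    intro x y h
    rw [← hpow x, ← hpow y]
    exact congr_arg (· ^ m) h
  rw [mordellCount_eq_sum_cube_roots, Finset.sum_congr rfl (g := fun _ => 1)]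
  · simp
  · intro y _
    obtain ⟨x, hx⟩ := (Finite.injective_iff_surjective.1 hinj) (y ^ 2 - c)
    rw [Finset.card_eq_one]
    refine ⟨x, ?_⟩
    ext z
    simp only [Finset.mem_filter, Finset.mem_univ, true_and, Finset.mem_singleton]
    rw [← hx]
    exact hinj.eq_iff

/-- A fibre over x has 0 or 2 points unless x³ + c = 0, when it has one. -/
theorem mordellCount_modEq_two (hF : ringChar F ≠ 2) (c : F) :
    (mordellCount F c : ℤ) ≡ (Finset.univ.filter fun x : F => x ^ 3 = -c).card [ZMOD 2] := by
  rw [mordellCount_eq_sum_quadraticChar hF, Finset.card_filter, Nat.cast_sum]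
  refine Int.ModEq.sum fun x _ => ?_
  rw [if_congr (add_eq_zero_iff_eq_neg (a := x ^ 3) (b := c)).symm rfl rfl]
  by_cases h0 : x ^ 3 + c = 0
  · simp [h0]
  · rcases quadraticChar_dichotomy h0 with h | h <;> simp [h, h0]

end MordellCount

/-- Mod p the Jacobi sum becomes ∑ x^(ma)(1-x)^(mb) with m = (p-1)/6, of degree below p - 1. This
places it in the prime `ker f` rather than its conjugate. -/
theorem IsSexticChar.map_jacobiSum_eq_zero {O : Type*} [CommRing O] {p : ℕ} [hpp : Fact p.Prime]
    {f : O →+* ZMod p} {ψ : MulChar (ZMod p) O} (hψ : IsSexticChar f ψ) (h6 : 6 ∣ p - 1) {a b : ℕ} (ha : a ≠ 0)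
    (hb : b ≠ 0) (hab : a + b < 6) : f (jacobiSum (ψ ^ a) (ψ ^ b)) = 0 := by
  obtain ⟨m, hm⟩ := h6
  have hp2 := hpp.out.two_le
  rw [jacobiSum, map_sum, ← sum_pow_mul_one_sub_pow_eq_zero (F := ZMod p) (m * a) (m * b)]
  · refine Finset.sum_congr rfl fun x _ => ?_
    rw [map_mul, MulChar.pow_apply' _ ha, MulChar.pow_apply' _ hb, map_pow, map_pow,
      hψ.map_apply, hψ.map_apply, ← pow_mul, ← pow_mul]
    have : (p - 1) / 6 = m := by omega
    rw [this]
  · rw [ZMod.card, hm, ← mul_add]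
    have : 0 < m := by omega
    nlinarith

/-! ### Divisibility of the point count, and its expression by Jacobi sums -/

section SexticCharacter

variable {O : Type*} [CommRing O] [IsDomain O] [CharZero O] {ω : O} (hω : IsPrimitiveRoot ω 6)
  {p : ℕ} [hpp : Fact p.Prime] (hp : 5 ≤ p) {f : O →+* ZMod p} {ψ : MulChar (ZMod p) O}
  (hψ : IsSexticChar f ψ)

include hp in
theorem ringChar_zmod_ne_two : ringChar (ZMod p) ≠ 2 := by
  rw [ZMod.ringChar_zmod_n]; omega

include hω hp hψ in
theorem IsSexticChar.cubic_mul_quadratic_ne_one : ψ ^ 2 * ψ ^ 3 ≠ 1 := by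
  intro h
  refine hψ.pow_three_ne_one hω hp ?_
  have h5 : ψ ^ 5 = 1 := by rw [← h, ← pow_add]
  have h1 : ψ = 1 := by
    have := hψ.pow_six_eq_one
    rwa [pow_succ, h5, one_mul] at this
  rw [h1, one_pow]

include hω hp hψ in
-- If c is a cube, so is -c, and its three cube roots are the abscissas of points of order 2.
theorem IsSexticChar.two_dvd_mordellCount_add_one {c : ZMod p} (h : ψ c ^ 2 = 1) :
    2 ∣ mordellCount (ZMod p) c + 1 := by
  have hneg : ψ (-c) ^ 2 = 1 := by
    rw [neg_eq_neg_one_mul, map_mul, mul_pow, h, mul_one, ← map_pow]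
    simp
  have h3 : (Finset.univ.filter fun x : ZMod p => x ^ 3 = -c).card = 3 := by
    have := hψ.card_cube_roots hω hp (-c)
    rw [hneg] at this
    have h4 : ((Finset.univ.filter fun x : ZMod p => x ^ 3 = -c).card : O) = (3 : ℕ) := by
      rw [this]; push_cast; norm_num
    exact_mod_cast h4
  have := mordellCount_modEq_two (ringChar_zmod_ne_two hp) c
  rw [h3] at this
  rw [Int.modEq_iff_dvd] at this
  omega

include hω hp hψ in
-- If c is a square, the points (0, ±√c) have order 3. In the count, each of these two ordinates has
-- one point above it and every other ordinate has 0 or 3.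
theorem IsSexticChar.three_dvd_mordellCount_add_one {c : ZMod p} (h : ψ c ^ 3 = 1) :
    3 ∣ mordellCount (ZMod p) c + 1 := by
  classical
  have hcard : (Finset.univ.filter fun y : ZMod p => y ^ 2 - c = 0).card = 2 := by
    have h1 := quadraticChar_card_sqrts (ringChar_zmod_ne_two hp) c
    have h2 : ((quadraticChar (ZMod p) c : ℤ) : O) = (1 : ℤ) := by
      have := congr_arg (fun φ : MulChar (ZMod p) O => φ c) (hψ.pow_three_eq hω hp)
      simp only [MulChar.pow_apply' _ three_ne_zero, h, MulChar.ringHomComp_apply] at this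
      rw [Int.cast_one, this]; rfl
    rw [Int.cast_inj.1 h2] at h1
    have h3 : (Finset.univ.filter fun y : ZMod p => y ^ 2 - c = 0) =
        {x : ZMod p | x ^ 2 = c}.toFinset := by
      ext y; simp [sub_eq_zero]
    rw [h3]
    exact_mod_cast h1
  have hmod : mordellCount (ZMod p) c ≡ 2 [MOD 3] := by
    suffices h : mordellCount (ZMod p) c ≡
        (Finset.univ.filter fun y : ZMod p => y ^ 2 - c = 0).card [MOD 3] by rwa [hcard] at h
    rw [mordellCount_eq_sum_cube_roots, Finset.card_filter]
    refine Nat.ModEq.sum fun y _ => ?_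
    have h1 := hψ.card_cube_roots hω hp (y ^ 2 - c)
    by_cases h0 : y ^ 2 - c = 0
    · rw [h0, MulChar.map_zero] at h1
      rw [h0, if_pos rfl]
      have h4 : ((Finset.univ.filter fun x : ZMod p => x ^ 3 = 0).card : O) = (1 : ℕ) := by
        rw [h1]; simp
      rw [Nat.cast_inj.1 h4]
    · rw [if_neg h0]
      have h3 : (ψ (y ^ 2 - c) ^ 2 - 1) *
          (1 + ψ (y ^ 2 - c) ^ 2 + (ψ (y ^ 2 - c) ^ 2) ^ 2) = 0 := by
        linear_combination hψ.apply_pow_six h0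
      rcases mul_eq_zero.1 h3 with h5 | h5
      · rw [sub_eq_zero.1 h5] at h1
        have h4 : ((Finset.univ.filter fun x : ZMod p => x ^ 3 = y ^ 2 - c).card : O) =
            (3 : ℕ) := by
          rw [h1]; push_cast; norm_num
        rw [Nat.cast_inj.1 h4]
        rfl
      · rw [h5] at h1
        rw [Nat.cast_eq_zero.1 h1]
  have := (hmod.add_right 1)
  exact (Nat.modEq_zero_iff_dvd).1 this

include hω hp hψ in
theorem IsSexticChar.mordellCount_eq {c : ZMod p} (hc : c ≠ 0) :
    (mordellCount (ZMod p) c : O) = p + (ψ ^ 2) (-c) * (ψ ^ 3) c * jacobiSum (ψ ^ 2) (ψ ^ 3) +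
      ((ψ ^ 2) ^ 2) (-c) * (ψ ^ 3) c * jacobiSum ((ψ ^ 2) ^ 2) (ψ ^ 3) := by
  classical
  have h1 := congr_arg (Int.castRingHom O)
    (mordellCount_eq_sum_quadraticChar (ringChar_zmod_ne_two hp) c)
  have hq (x : ZMod p) : ((quadraticChar (ZMod p) x : ℤ) : O) = (ψ ^ 3) x := by
    rw [hψ.pow_three_eq hω hp]; rfl
  simp only [map_natCast, map_sum, map_add, eq_intCast, hq, map_one] at h1
  rw [h1, Finset.sum_add_distrib, ← sum_mul_apply_add_eq_jacobiSum _ _ hc,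
    ← sum_mul_apply_add_eq_jacobiSum _ _ hc]
  -- Group the x by their cube b, weighting b by its number of cube roots.
  have hfib : ∑ x : ZMod p, (ψ ^ 3) (x ^ 3 + c) =
      ∑ b : ZMod p, (1 + ψ b ^ 2 + (ψ b ^ 2) ^ 2) * (ψ ^ 3) (b + c) := by
    rw [← Finset.sum_fiberwise Finset.univ (fun x : ZMod p => x ^ 3)]
    refine Finset.sum_congr rfl fun b _ => ?_
    rw [← hψ.card_cube_roots hω hp b, ← nsmul_eq_mul]
    refine Finset.sum_eq_card_nsmul fun x hx => ?_
    rw [(Finset.mem_filter.1 hx).2]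
  have hzero : ∑ b : ZMod p, (ψ ^ 3) (b + c) = 0 := by
    rw [← MulChar.sum_eq_zero_of_ne_one (hψ.pow_three_ne_one hω hp)]
    exact Fintype.sum_equiv (Equiv.addRight c) _ _ fun x => rfl
  rw [hfib]
  simp_rw [add_mul, one_mul, Finset.sum_add_distrib, hzero, zero_add]
  simp only [MulChar.pow_apply' _ two_ne_zero, Finset.sum_const, Finset.card_univ, ZMod.card,
    nsmul_eq_mul, mul_one]
  ring

end SexticCharacter

theorem exists_ringHom_zmod_of_absNorm_eq {O : Type*} [CommRing O]
    [IsDedekindDomain O] [Module.Free ℤ O] {p : ℕ} [hpp : Fact p.Prime] (I : Ideal O)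
    (hI : Ideal.absNorm I = p) : ∃ f : O →+* ZMod p, RingHom.ker f = I := by
  have hc : Nat.card (O ⧸ I) = p := by rw [← hI, Ideal.absNorm_apply, Submodule.cardQuot_apply]
  have : Finite (O ⧸ I) := Nat.finite_of_card_ne_zero (by rw [hc]; exact hpp.out.ne_zero)
  have := Fintype.ofFinite (O ⧸ I)
  rw [Nat.card_eq_fintype_card] at hc
  let e := (ZMod.ringEquivOfPrime (O ⧸ I) hpp.out hc).symm
  refine ⟨(e : O ⧸ I →+* ZMod p).comp (Ideal.Quotient.mk I), ?_⟩
  ext x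
  rw [RingHom.mem_ker, RingHom.comp_apply, RingEquiv.coe_toRingHom, map_eq_zero_iff _ e.injective,
    Ideal.Quotient.eq_zero_iff_mem]

/-! ### Arithmetic of the Eisenstein integers -/

section Eisenstein

variable {K : Type*} [Field K] [NumberField K] {s : K} (hs : s ^ 2 = -3)
  (hK : IntermediateField.adjoin ℚ {s} = ⊤) {ω : 𝓞 K} (hω : (ω : K) = (1 + s) / 2)

include hK in
theorem algebra_adjoin_eq_top : Algebra.adjoin ℚ {s} = ⊤ := by
  rw [← IntermediateField.adjoin_simple_toSubalgebra_of_isAlgebraic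
    (Algebra.IsAlgebraic.isAlgebraic s), hK, IntermediateField.top_toSubalgebra]

include hs hω in
theorem eisenstein_sq : ω ^ 2 = ω - 1 := by
  apply RingOfIntegers.coe_injective (K := K)
  change (ω : K) ^ 2 = (ω : K) - 1
  rw [hω]
  linear_combination hs / 4

include hs hω in
theorem eisenstein_isPrimitiveRoot : IsPrimitiveRoot ω 6 := by
  have h2 := eisenstein_sq hs hω
  have h3 : ω ^ 3 = -1 := by linear_combination (ω + 1) * h2
  have hne1 : ω ^ 2 ≠ 1 := by
    intro h
    have h4 : ω = 2 := by linear_combination h - h2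
    rw [h4] at h2
    norm_num at h2
  rw [IsPrimitiveRoot.iff_orderOf]
  refine orderOf_eq_of_pow_and_pow_div_prime (by norm_num) ?_ ?_
  · linear_combination (ω ^ 3 - 1) * h3
  · intro q hq hdvd
    have : q ≤ 6 := Nat.le_of_dvd (by norm_num) hdvd
    interval_cases q <;> first | (exfalso; revert hq; norm_num; done) | skip
    · rw [show 6 / 2 = 3 from rfl, h3]
      norm_num
    · exact hne1
    all_goals omega

include hs hK hω in
theorem eisenstein_isCyclotomicExtension : IsCyclotomicExtension {3} ℚ K := by
  have h6 := (eisenstein_isPrimitiveRoot hs hω).map_of_injective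
    (RingOfIntegers.coe_injective (K := K))
  have h3 : IsPrimitiveRoot ((ω : K) ^ 2) 3 := h6.pow (by norm_num) (by norm_num)
  refine (IsCyclotomicExtension.iff_singleton 3 ℚ K).2 ⟨⟨_, h3⟩, fun x => ?_⟩
  have hx : x ∈ Algebra.adjoin ℚ {s} := by rw [algebra_adjoin_eq_top hK]; trivial
  refine Algebra.adjoin_le ?_ hx
  rw [Set.singleton_subset_iff]
  have hs' : s = 2 * (ω : K) ^ 2 + 1 := by rw [hω]; linear_combination -hs / 2
  rw [hs']
  refine add_mem (mul_mem ?_ (Algebra.subset_adjoin h3.pow_eq_one)) (one_mem _)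
  exact ofNat_mem (Algebra.adjoin ℚ {b : K | b ^ 3 = 1}) 2

include hs hK hω in
theorem exists_eisenstein_conj : ∃ σ : 𝓞 K →+* 𝓞 K, σ ω = ω ^ 5 ∧
    ∀ x, ((Algebra.trace ℤ (𝓞 K) x : ℤ) : 𝓞 K) = x + σ x ∧
      ((Algebra.norm ℤ x : ℤ) : 𝓞 K) = x * σ x := by
  classical
  have hcyc := eisenstein_isCyclotomicExtension hs hK hω
  have : IsGalois ℚ K := IsCyclotomicExtension.isGalois {3} ℚ K
  have hfin : Module.finrank ℚ K = 2 := by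
    rw [IsCyclotomicExtension.finrank (n := 3) K
      (Polynomial.cyclotomic.irreducible_rat (by norm_num))]
    rfl
  have hcard : Fintype.card (K ≃ₐ[ℚ] K) = 2 := by
    rw [← Nat.card_eq_fintype_card, IsGalois.card_aut_eq_finrank, hfin]
  have : Nontrivial (K ≃ₐ[ℚ] K) := Fintype.one_lt_card_iff_nontrivial.1 (by omega)
  obtain ⟨τ, hτ⟩ := exists_ne (1 : K ≃ₐ[ℚ] K)
  have huniv : (Finset.univ : Finset (K ≃ₐ[ℚ] K)) = {1, τ} := by
    symm
    apply Finset.eq_univ_of_card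
    rw [hcard, Finset.card_pair hτ.symm]
  have hτs : τ s = -s := by
    have h1 : (τ s - s) * (τ s + s) = 0 := by
      have : τ s ^ 2 = -3 := by rw [← map_pow, hs, map_neg, map_ofNat]
      linear_combination this - hs
    rcases mul_eq_zero.1 h1 with h | h
    · exfalso
      apply hτ
      have : (τ : K →ₐ[ℚ] K) = AlgHom.id ℚ K := by
        refine AlgHom.ext_of_adjoin_eq_top (algebra_adjoin_eq_top hK) ?_
        rintro _ rfl
        exact sub_eq_zero.1 h
      ext x
      exact congr_arg (fun φ : K →ₐ[ℚ] K => φ x) this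
    · exact eq_neg_of_add_eq_zero_left h
  refine ⟨RingOfIntegers.mapRingHom τ, ?_, fun x => ⟨?_, ?_⟩⟩
  · have h2 := eisenstein_sq hs hω
    have h5 : ω ^ 5 = 1 - ω := by
      linear_combination (ω ^ 3 + ω ^ 2 - 1) * h2
    rw [h5]
    apply RingOfIntegers.coe_injective (K := K)
    change τ (ω : K) = 1 - (ω : K)
    rw [hω, map_div₀, map_add, hτs, map_one,
      map_ofNat]
    ring
  · apply RingOfIntegers.coe_injective (K := K)
    rw [map_intCast]
    change _ = (x : K) + τ (x : K)
    have h1 := Algebra.coe_trace_int x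
    have h2 := trace_eq_sum_automorphisms (K := ℚ) (x : K)
    rw [huniv, Finset.sum_pair hτ.symm, ← h1] at h2
    simpa using h2
  · apply RingOfIntegers.coe_injective (K := K)
    rw [map_intCast]
    change _ = (x : K) * τ (x : K)
    have h1 := Algebra.coe_norm_int x
    have h2 := Algebra.norm_eq_prod_automorphisms ℚ (x : K)
    rw [huniv, Finset.prod_pair hτ.symm, ← h1] at h2
    simpa using h2

include hs hK hω in
theorem exists_ringHom_zmod {p : ℕ} [hpp : Fact p.Prime] (hp3 : p % 3 = 1)
    (P : HeightOneSpectrum (𝓞 K)) (hP : (p : 𝓞 K) ∈ P.asIdeal) :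
    ∃ f : 𝓞 K →+* ZMod p, RingHom.ker f = P.asIdeal := by
  have hcyc := eisenstein_isCyclotomicExtension hs hK hω
  have : P.asIdeal.LiesOver (Ideal.span {(p : ℤ)}) := by
    rw [Ideal.liesOver_iff]
    refine ((Int.ideal_span_isMaximal_of_prime p).eq_of_le ?_ ?_)
    · exact (Ideal.IsPrime.under ℤ P.asIdeal).ne_top
    · rw [Ideal.span_singleton_le_iff_mem, Ideal.mem_comap]
      simpa using hP
  have hdeg : P.asIdeal.inertiaDeg ℤ = 1 := by
    rw [IsCyclotomicExtension.Rat.inertiaDeg_eq_of_not_dvd p P.asIdeal (m := 3) (K := K)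
      (by intro h; have := (Nat.prime_dvd_prime_iff_eq hpp.out Nat.prime_three).1 h; omega)]
    rw [orderOf_eq_one_iff]
    have := (ZMod.natCast_eq_natCast_iff p 1 3).2 hp3
    simpa using this
  have hnorm : Ideal.absNorm P.asIdeal = p := by
    rw [← Ideal.natAbs_pow_inertiaDeg (p : ℤ) P.asIdeal, hdeg, pow_one, Int.natAbs_natCast]
  exact exists_ringHom_zmod_of_absNorm_eq P.asIdeal hnorm

end Eisenstein

section SexticCharacter

variable {O : Type*} [CommRing O] {p : ℕ} [hpp : Fact p.Prime] {f : O →+* ZMod p}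
  {ψ : MulChar (ZMod p) O}

theorem IsSexticChar.inv_pow_two (hψ : IsSexticChar f ψ) : (ψ ^ 2)⁻¹ = (ψ ^ 2) ^ 2 :=
  inv_eq_of_mul_eq_one_right (by rw [← pow_succ', ← pow_mul, hψ.pow_six_eq_one])

theorem IsSexticChar.inv_pow_three (hψ : IsSexticChar f ψ) : (ψ ^ 3)⁻¹ = ψ ^ 3 :=
  inv_eq_of_mul_eq_one_right (by rw [← pow_add, hψ.pow_six_eq_one])

theorem IsSexticChar.pow_pow_six (hψ : IsSexticChar f ψ) (n : ℕ) : (ψ ^ n) ^ 6 = 1 := by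
  rw [pow_right_comm, hψ.pow_six_eq_one, one_pow]

end SexticCharacter

/-! ### Conjugation acting on Jacobi sums -/

section Conjugation

variable {O : Type*} [CommRing O] [IsDomain O] {ω : O} (hω : IsPrimitiveRoot ω 6)
  {σ : O →+* O} (hσ : σ ω = ω ^ 5)

include hω in
theorem eisenstein_sq_of_isPrimitiveRoot : ω ^ 2 = ω - 1 := by
  have h3 : IsPrimitiveRoot (ω ^ 3) 2 := hω.pow (by norm_num) (by norm_num)
  have h1 := h3.eq_neg_one_of_two_right
  have h2 : IsPrimitiveRoot (ω ^ 2) 3 := hω.pow (by norm_num) (by norm_num)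
  have hne : ω + 1 ≠ 0 := by
    intro h
    have : ω = -1 := eq_neg_of_add_eq_zero_left h
    rw [this] at h2
    exact h2.ne_one (by norm_num) (by norm_num)
  have : (ω + 1) * (ω ^ 2 - ω + 1) = 0 := by linear_combination h1
  linear_combination (mul_eq_zero.1 this).resolve_left hne

include hω hσ in
theorem conj_eq_pow_five {x : O} (hx : x ^ 6 = 1) : σ x = x ^ 5 := by
  obtain ⟨i, -, rfl⟩ := hω.eq_pow_of_pow_eq_one hx
  rw [map_pow, hσ, pow_right_comm]

include hω hσ in
theorem MulChar.ringHomComp_conj {F : Type*} [Field F] {χ : MulChar F O} (hχ : χ ^ 6 = 1) :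
    χ.ringHomComp σ = χ⁻¹ := by
  have hinv : χ⁻¹ = χ ^ 5 := inv_eq_of_mul_eq_one_right (by rw [← pow_succ', hχ])
  ext x
  rw [hinv, MulChar.ringHomComp_apply, MulChar.pow_apply' _ (by norm_num)]
  refine conj_eq_pow_five hω hσ ?_
  rw [← MulChar.pow_apply' _ (by norm_num), hχ, MulChar.one_apply x.isUnit]

include hω hσ in
theorem conj_jacobiSum {F : Type*} [Field F] [Fintype F] {χ φ : MulChar F O} (hχ : χ ^ 6 = 1)
    (hφ : φ ^ 6 = 1) : σ (jacobiSum χ φ) = jacobiSum χ⁻¹ φ⁻¹ := by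
  rw [← jacobiSum_ringHomComp, MulChar.ringHomComp_conj hω hσ hχ, MulChar.ringHomComp_conj hω hσ hφ]

variable {p : ℕ} [hpp : Fact p.Prime] {f : O →+* ZMod p} {ψ : MulChar (ZMod p) O}

include hω in
theorem IsSexticChar.three_dvd_jacobiSum_add_one (hψ : IsSexticChar f ψ) (hp : 5 ≤ p) :
    (3 : O) ∣ jacobiSum (ψ ^ 2) (ψ ^ 2) + 1 := by
  have h3 : (ψ ^ 2) ^ 3 = 1 := by rw [← pow_mul, hψ.pow_six_eq_one]
  have h6 := six_dvd_sub_one hω hp f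
  obtain ⟨z, -, hz⟩ := exists_jacobiSum_eq_neg_one_add (n := 3) (by norm_num) h3 h3
    (by rw [ZMod.card]; omega)
    (hω.pow (by norm_num) (by norm_num) : IsPrimitiveRoot (ω ^ 2) 3)
  have h2 := eisenstein_sq_of_isPrimitiveRoot hω
  -- Here (ω² - 1)² = 3(1 - ω).
  refine ⟨z * (1 - ω), ?_⟩
  rw [hz]
  linear_combination z * (ω ^ 2 + ω - 2) * h2

include hω hσ in
/-- The Frobenius at a prime of degree one, as a multiple of a Jacobi sum. -/
theorem IsSexticChar.exists_frobenius [CharZero O] (hψ : IsSexticChar f ψ) (hp : 5 ≤ p)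
    {c : ZMod p} (hc : c ≠ 0) :
    ∃ x : O, f x = 0 ∧ x * σ x = p ∧ (mordellCount (ZMod p) c : O) = p - (x + σ x) := by
  have hJ := jacobiSum_mul_jacobiSum_inv_of_charZero (hψ.pow_two_ne_one hω hp)
    (hψ.pow_three_ne_one hω hp) (hψ.cubic_mul_quadratic_ne_one hω hp)
  have hconj : σ ((ψ ^ 2) (-c) * (ψ ^ 3) c * jacobiSum (ψ ^ 2) (ψ ^ 3)) =
      ((ψ ^ 2) ^ 2) (-c) * (ψ ^ 3) c * jacobiSum ((ψ ^ 2) ^ 2) (ψ ^ 3) := by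
    have h2 := congr_arg (fun χ : MulChar (ZMod p) O => χ (-c))
      (MulChar.ringHomComp_conj hω hσ (hψ.pow_pow_six 2))
    have h3 := congr_arg (fun χ : MulChar (ZMod p) O => χ c)
      (MulChar.ringHomComp_conj hω hσ (hψ.pow_pow_six 3))
    simp only [MulChar.ringHomComp_apply] at h2 h3
    rw [map_mul, map_mul, h2, h3, conj_jacobiSum hω hσ (hψ.pow_pow_six 2) (hψ.pow_pow_six 3),
      hψ.inv_pow_two, hψ.inv_pow_three]
  refine ⟨-((ψ ^ 2) (-c) * (ψ ^ 3) c * jacobiSum (ψ ^ 2) (ψ ^ 3)), ?_, ?_, ?_⟩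
  · rw [map_neg, map_mul, hψ.map_jacobiSum_eq_zero (six_dvd_sub_one hω hp f) two_ne_zero
      three_ne_zero (by norm_num), mul_zero, neg_zero]
  · rw [hψ.inv_pow_two, hψ.inv_pow_three, ZMod.card] at hJ
    rw [map_neg σ, hconj, neg_mul_neg]
    have h1 : (ψ ^ 2) (-c) * ((ψ ^ 2) ^ 2) (-c) = 1 := by
      rw [← MulChar.mul_apply, ← pow_succ', ← pow_mul, hψ.pow_six_eq_one,
        MulChar.one_apply (neg_ne_zero.2 hc).isUnit]
    have h2 : (ψ ^ 3) c * (ψ ^ 3) c = 1 := by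
      rw [← MulChar.mul_apply, ← pow_add, hψ.pow_six_eq_one, MulChar.one_apply hc.isUnit]
    rw [← hJ]
    calc _ = ((ψ ^ 2) (-c) * ((ψ ^ 2) ^ 2) (-c)) * ((ψ ^ 3) c * (ψ ^ 3) c) *
          (jacobiSum (ψ ^ 2) (ψ ^ 3) * jacobiSum ((ψ ^ 2) ^ 2) (ψ ^ 3)) := by ring
      _ = _ := by rw [h1, h2, one_mul, one_mul]
  · rw [map_neg σ, hconj, hψ.mordellCount_eq hω hp hc]
    ring

end Conjugation

/-! ### Generators of primes and the symbol of 2 -/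

section Generators

variable {K : Type*} [Field K] [NumberField K] {ω : 𝓞 K} (hω : IsPrimitiveRoot ω 6)
  {σ : 𝓞 K →+* 𝓞 K} (hσ : σ ω = ω ^ 5)
  (hnorm : ∀ x : 𝓞 K, ((Algebra.norm ℤ x : ℤ) : 𝓞 K) = x * σ x)

include hnorm in
theorem absNorm_span_of_mul_conj {x : 𝓞 K} {p : ℕ} (h : x * σ x = p) :
    Ideal.absNorm (Ideal.span {x}) = p := by
  rw [Ideal.absNorm_span_singleton]
  have : Algebra.norm ℤ x = p := by
    have := (hnorm x).trans h
    exact_mod_cast this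
  rw [this, Int.natAbs_natCast]

include hnorm in
theorem span_eq_ker_of_mul_conj {x : 𝓞 K} {p : ℕ} [hpp : Fact p.Prime] (h : x * σ x = p)
    {f : 𝓞 K →+* ZMod p} (hf : f x = 0) : Ideal.span {x} = RingHom.ker f := by
  have hn := absNorm_span_of_mul_conj hnorm h
  have hprime : (Ideal.span {x}).IsPrime :=
    Ideal.isPrime_of_irreducible_absNorm (by rw [hn]; exact hpp.out)
  have hne : Ideal.span {x} ≠ ⊥ := by
    intro h0
    rw [h0, Ideal.absNorm_bot] at hn
    exact hpp.out.ne_zero hn.symm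
  refine (hprime.isMaximal hne).eq_of_le (RingHom.ker_ne_top f) ?_
  rw [Ideal.span_singleton_le_iff_mem]
  exact hf

theorem absNorm_eq_of_ker_eq {p : ℕ} [hpp : Fact p.Prime] {f : 𝓞 K →+* ZMod p} {I : Ideal (𝓞 K)}
    (hf : RingHom.ker f = I) : Ideal.absNorm I = p := by
  rw [Ideal.absNorm_apply, Submodule.cardQuot_apply, ← hf]
  exact (Nat.card_congr (RingHom.quotientKerEquivOfSurjective
    (ZMod.ringHom_surjective f)).toEquiv).trans (Nat.card_zmod p)

/-- The root chosen in the definition is the only one, since sixth roots of unity inject into 𝔽_p.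
-/
theorem sexticSymbol_eq {p : ℕ} [hpp : Fact p.Prime] (hp : 5 ≤ p) {f : 𝓞 K →+* ZMod p}
    {I : Ideal (𝓞 K)} (hf : RingHom.ker f = I) {ψ : MulChar (ZMod p) (𝓞 K)}
    (hψ : IsSexticChar f ψ) {α : 𝓞 K} (hα : f α ≠ 0) : sexticSymbol α I = ψ (f α) := by
  have hex : ∃ ζ : 𝓞 K, ζ ^ 6 = 1 ∧ ζ - α ^ ((Ideal.absNorm I - 1) / 6) ∈ I := by
    refine ⟨ψ (f α), hψ.apply_pow_six hα, ?_⟩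
    rw [absNorm_eq_of_ker_eq hf, ← hf, RingHom.mem_ker, map_sub, hψ.map_apply, map_pow, sub_self]
  rw [sexticSymbol, dif_pos hex]
  obtain ⟨h1, h2⟩ := hex.choose_spec
  refine eq_of_pow_six_eq_one hp f h1 (hψ.apply_pow_six hα) ?_
  have hmem (x : 𝓞 K) : x ∈ I ↔ f x = 0 := by rw [← hf, RingHom.mem_ker]
  rw [hmem, map_sub, sub_eq_zero, map_pow] at h2
  rw [h2, hψ.map_apply, absNorm_eq_of_ker_eq hf]

theorem isPrimitiveRoot_coe_sq {K : Type*} [Field K] {ω : 𝓞 K} (hω : IsPrimitiveRoot ω 6) :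
    IsPrimitiveRoot ((ω : K) ^ 2) 3 :=
  (hω.map_of_injective (RingOfIntegers.coe_injective (K := K))).pow (by norm_num) (by norm_num)

include hω hσ hnorm in
/-- The Jacobi sum of a cubic residue character is a primary generator of its prime. -/
theorem IsSexticChar.span_jacobiSum_eq {p : ℕ} [hpp : Fact p.Prime] (hp : 5 ≤ p)
    {f : 𝓞 K →+* ZMod p} {ψ : MulChar (ZMod p) (𝓞 K)} (hψ : IsSexticChar f ψ) :
    Ideal.span {jacobiSum (ψ ^ 2) (ψ ^ 2)} = RingHom.ker f := by
  refine span_eq_ker_of_mul_conj hnorm ?_ (hψ.map_jacobiSum_eq_zero (six_dvd_sub_one hω hp f)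
    two_ne_zero two_ne_zero (by norm_num))
  have h2 := hψ.pow_two_ne_one hω hp
  rw [conj_jacobiSum hω hσ (hψ.pow_pow_six 2) (hψ.pow_pow_six 2),
    jacobiSum_mul_jacobiSum_inv_of_charZero h2 h2, ZMod.card]
  rw [← sq, ← hψ.inv_pow_two]
  exact inv_ne_one.2 h2

include hnorm in
theorem not_two_dvd_one : ¬ (2 : 𝓞 K) ∣ 1 := by
  rintro ⟨m, hm⟩
  have h := congr_arg (Algebra.norm ℤ) hm
  have h2 : Algebra.norm ℤ (2 : 𝓞 K) = 4 := by
    have : ((Algebra.norm ℤ (2 : 𝓞 K) : ℤ) : 𝓞 K) = (4 : ℤ) := by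
      rw [hnorm, map_ofNat]; push_cast; norm_num
    exact_mod_cast this
  rw [map_one, map_mul, h2] at h
  omega

variable [IsCyclotomicExtension {3} ℚ K]

include hω in
theorem eisenstein_unit_pow_six (u : (𝓞 K)ˣ) : (u : 𝓞 K) ^ 6 = 1 := by
  have h3 := isPrimitiveRoot_coe_sq hω
  have hmem := IsCyclotomicExtension.Rat.Three.Units.mem h3 u
  have hη3 : h3.toInteger ^ 3 = 1 := h3.toInteger_cube_eq_one
  have e1 : h3.toInteger ^ 6 = 1 := by linear_combination (h3.toInteger ^ 3 + 1) * hη3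
  have e2 : h3.toInteger ^ 12 = 1 := by
    linear_combination (h3.toInteger ^ 6 + 1) * e1
  simp only [List.mem_cons, List.not_mem_nil, or_false] at hmem
  rcases hmem with rfl | rfl | rfl | rfl | rfl | rfl
  · simp
  · simp [Even.neg_one_pow (show Even 6 by decide)]
  all_goals
    simp only [Units.val_neg, Units.val_pow_eq_pow_val, IsUnit.unit_spec,
      Even.neg_pow (show Even 6 by decide), ← pow_mul, e1, e2]

include hω in
theorem eisenstein_unit_eq_one_or_neg_one {u : (𝓞 K)ˣ} (h : (3 : 𝓞 K) ∣ u - 1) :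
    u = 1 ∨ u = -1 := by
  have h3 := isPrimitiveRoot_coe_sq hω
  refine IsCyclotomicExtension.Rat.Three.eq_one_or_neg_one_of_unit_of_congruent h3 u ⟨1, ?_⟩
  have hint : h3.toInteger = ω ^ 2 := by ext; rfl
  have h2 := eisenstein_sq_of_isPrimitiveRoot hω
  rw [Int.cast_one]
  -- With λ = ω² - 1 one has 3 = λ²ω, so congruence mod 3 implies congruence mod λ².
  refine Dvd.dvd.trans ⟨ω, ?_⟩ h
  rw [hint]
  linear_combination (-ω ^ 3 - ω ^ 2 + 2 * ω + 3) * h2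

include hω hσ in
theorem mul_conj_eq_of_span_eq {x y : 𝓞 K} (h : Ideal.span {x} = Ideal.span {y}) :
    x * σ x = y * σ y := by
  obtain ⟨u, rfl⟩ := Ideal.span_singleton_eq_span_singleton.1 h
  have hu := eisenstein_unit_pow_six hω u
  rw [map_mul, conj_eq_pow_five hω hσ hu]
  linear_combination (-(x * σ x)) * hu

include hω hσ hnorm in
/-- The cubic residue characters of `2` at `π` and `1 - π` are inverse to each other. -/
theorem cubic_apply_two_mul_eq_one {p q : ℕ} [hpp : Fact p.Prime] [hqq : Fact q.Prime]
    (hp : 5 ≤ p) (hq : 5 ≤ q) {f : 𝓞 K →+* ZMod p} {g : 𝓞 K →+* ZMod q} {π : 𝓞 K}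
    (hf : Ideal.span {π} = RingHom.ker f) (hg : Ideal.span {1 - π} = RingHom.ker g)
    (hπ : π * σ π = p) (hπ' : (1 - π) * σ (1 - π) = q)
    {ψ : MulChar (ZMod p) (𝓞 K)} (hψ : IsSexticChar f ψ)
    {φ : MulChar (ZMod q) (𝓞 K)} (hφ : IsSexticChar g φ) :
    ψ 2 ^ 2 * φ 2 ^ 2 = 1 := by
  have h2p : (2 : ZMod p) ≠ 0 := by
    exact_mod_cast natCast_ne_zero_of_lt_prime hpp.out (CharP.cast_eq_zero (ZMod p) p)
      two_ne_zero (by omega)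
  have h2q : (2 : ZMod q) ≠ 0 := by
    exact_mod_cast natCast_ne_zero_of_lt_prime hqq.out (CharP.cast_eq_zero (ZMod q) q)
      two_ne_zero (by omega)
  obtain ⟨u, hu⟩ := Ideal.span_singleton_eq_span_singleton.1
    ((hψ.span_jacobiSum_eq hω hσ hnorm hp).trans hf.symm)
  obtain ⟨v, hv⟩ := Ideal.span_singleton_eq_span_singleton.1
    ((hφ.span_jacobiSum_eq hω hσ hnorm hq).trans hg.symm)
  obtain ⟨a, ha⟩ := hψ.three_dvd_jacobiSum_add_one hω hp
  obtain ⟨b, hb⟩ := hφ.three_dvd_jacobiSum_add_one hω hq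
  obtain ⟨a', ha'⟩ := two_dvd_jacobiSum_sub h2p (ψ ^ 2)
    (by rw [← pow_mul, hψ.pow_six_eq_one])
  obtain ⟨b', hb'⟩ := two_dvd_jacobiSum_sub h2q (φ ^ 2)
    (by rw [← pow_mul, hφ.pow_six_eq_one])
  rw [MulChar.pow_apply' _ two_ne_zero] at ha' hb'
  set J := jacobiSum (ψ ^ 2) (ψ ^ 2)
  set J' := jacobiSum (φ ^ 2) (φ ^ 2)
  obtain ⟨m, hm⟩ := six_dvd_sub_one hω hp f
  obtain ⟨n, hn⟩ := six_dvd_sub_one hω hq g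
  have hm' : (p : 𝓞 K) = 6 * m + 1 := by
    have : p = 6 * m + 1 := by omega
    rw [this]; push_cast; ring
  have hn' : (q : 𝓞 K) = 6 * n + 1 := by
    have : q = 6 * n + 1 := by omega
    rw [this]; push_cast; ring
  rw [hm'] at hπ
  rw [hn', map_sub, map_one] at hπ'
  -- From ππ̄ = p and (1-π)(1-π̄) = q follows π(1-π) = (1-π)p + πq, which is 1 mod 6.
  have hprod : π * (1 - π) = 1 + 6 * (m + π * (n - m)) := by
    linear_combination (1 - π) * hπ + π * hπ'
  have hJJ : ((u * v : (𝓞 K)ˣ) : 𝓞 K) * (J * J') = 1 + 6 * (m + π * (n - m)) := by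
    rw [← hprod, ← hv, ← hu]; push_cast; ring
  have h3 : (3 : 𝓞 K) ∣ (u * v : (𝓞 K)ˣ) - 1 := by
    refine ⟨2 * (m + π * (n - m)) - (u * v : (𝓞 K)ˣ) * (3 * a * b - a - b), ?_⟩
    have hJ : J = 3 * a - 1 := by linear_combination ha
    have hJ' : J' = 3 * b - 1 := by linear_combination hb
    rw [hJ, hJ'] at hJJ
    linear_combination hJJ
  -- Mod 2 the sign of uv is invisible and each Jacobi sum becomes its cubic symbol of 2.
  have h2 : (2 : 𝓞 K) ∣ ψ 2 ^ 2 * φ 2 ^ 2 - 1 := by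
    have hJ : J = ψ 2 ^ 2 + 2 * a' := by linear_combination ha'
    have hJ' : J' = φ 2 ^ 2 + 2 * b' := by linear_combination hb'
    rw [hJ, hJ'] at hJJ
    rcases eisenstein_unit_eq_one_or_neg_one hω h3 with h | h
    · rw [h, Units.val_one] at hJJ
      exact ⟨3 * (m + π * (n - m)) - ψ 2 ^ 2 * b' - φ 2 ^ 2 * a' - 2 * a' * b', by
        linear_combination hJJ⟩
    · rw [h, Units.val_neg, Units.val_one] at hJJ
      exact ⟨-1 - 3 * (m + π * (n - m)) - ψ 2 ^ 2 * b' - φ 2 ^ 2 * a' - 2 * a' * b', by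
        linear_combination -hJJ⟩
  obtain ⟨z, hz⟩ := h2
  have hy3 : (ψ 2 ^ 2 * φ 2 ^ 2) ^ 3 = 1 := by
    linear_combination φ 2 ^ 6 * hψ.apply_pow_six h2p + hφ.apply_pow_six h2q
  set y := ψ 2 ^ 2 * φ 2 ^ 2
  by_contra hne
  have hy : (y - 1) * (y ^ 2 + y + 1) = 0 := by linear_combination hy3
  -- A nontrivial cube root of unity y = 1 + 2z would satisfy y² + y + 1 = 3 + 6z + 4z² = 0, forcing
  -- 2 ∣ 1.
  have hy2 := (mul_eq_zero.1 hy).resolve_left (sub_ne_zero.2 hne)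
  have hyz : y = 1 + 2 * z := by linear_combination hz
  refine not_two_dvd_one hnorm ⟨-(2 * z ^ 2 + 3 * z + 1), ?_⟩
  rw [hyz] at hy2
  linear_combination hy2

end Generators

/-- T is the affine count, so p - T is the trace of Frobenius. The trivial bound T ≤ 2p suffices in
place of Hasse's: it leaves q = 1, p + 1 or 2p + 1, all impossible for p, q ≡ 1 mod 6 and q ≥ 5. -/
theorem not_dvd_trace_of_mod_six {p q T : ℕ} (hp : 5 ≤ p) (hp6 : 6 ∣ p - 1) (hq6 : 6 ∣ q - 1)
    (hq : 5 ≤ q) (hT : T + 1 = q) (hle : T ≤ 2 * p) : ¬ (p : ℤ) ∣ p - T := by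
  rintro ⟨m, hm⟩
  have h1 : -1 ≤ m := by nlinarith
  have h2 : m ≤ 1 := by nlinarith
  interval_cases m <;> omega

/-! ### Assembly of the main theorem -/

theorem proposition23 {K : Type*} [Field K] [NumberField K]
    (s : K) (hs : s ^ 2 = -3) (hK : IntermediateField.adjoin ℚ {s} = ⊤)
    (ω : 𝓞 K) (hω : (ω : K) = (1 + s) / 2)
    (k : ℤ) (hk : k ≠ 0)
    (p q : ℕ) [Fact p.Prime] [Fact q.Prime] (hp : 5 ≤ p) (hq : 5 ≤ q)
    (hgp : GoodReductionAt (mordellCurve k) p) (hgq : GoodReductionAt (mordellCurve k) q)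
    (hpq : pointCountAt (mordellCurve k) p = q)
    (P : HeightOneSpectrum (𝓞 K)) (hP : (p : 𝓞 K) ∈ P.asIdeal) :
    -- the value `ψ_E(𝔭)` is well defined
    (∃! π : 𝓞 K, IsGrossencharacterValue (mordellCurve k) P π) ∧
    -- (a)
    (¬ (p : ℤ) ∣ k →
      sexticSymbol (k : 𝓞 K) P.asIdeal = ω ∨ sexticSymbol (k : 𝓞 K) P.asIdeal = ω ^ 5) ∧
    -- (b), with `𝔮 = (1 - ψ_E(𝔭))`
    (∀ π : 𝓞 K, IsGrossencharacterValue (mordellCurve k) P π →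
      sexticSymbol 2 P.asIdeal * sexticSymbol 2 (Ideal.span {1 - π}) =
          ((legendreSym p 2 * legendreSym q 2 : ℤ) : 𝓞 K) ∧
      (sexticSymbol 2 P.asIdeal * sexticSymbol 2 (Ideal.span {1 - π}) = 1 ∨
        sexticSymbol 2 P.asIdeal * sexticSymbol 2 (Ideal.span {1 - π}) = -1)) := by
  have hpp : p.Prime := Fact.out
  have hqq : q.Prime := Fact.out
  obtain ⟨a, k₀, hk₀, hka⟩ := exists_eq_pow_six_mul_of_goodReductionAt hk hp hgp
  rw [pointCountAt_mordellCurve hp hk₀ hka] at hpq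
  have hp2 : p % 2 = 1 := hpp.eq_two_or_odd.resolve_left (by omega)
  have hq2 : q % 2 = 1 := hqq.eq_two_or_odd.resolve_left (by omega)
  have hp3 : p % 3 = 1 := by
    have h0 : p % 3 ≠ 0 := fun h => by
      have := (Nat.prime_dvd_prime_iff_eq Nat.prime_three hpp).1 (Nat.dvd_of_mod_eq_zero h)
      omega
    by_contra h1
    have := mordellCount_eq_card (F := ZMod p) (by rw [ZMod.card]; omega) k₀
    rw [ZMod.card] at this
    omega
  have hω6 := eisenstein_isPrimitiveRoot hs hω
  have hcyc := eisenstein_isCyclotomicExtension hs hK hω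
  obtain ⟨σ, hσ, hσx⟩ := exists_eisenstein_conj hs hK hω
  have hnorm := fun x => (hσx x).2
  obtain ⟨f, hf⟩ := exists_ringHom_zmod hs hK hω hp3 P hP
  obtain ⟨ψ, hψ⟩ := exists_isSexticChar hω6 hp f
  have hk₀' : (k₀ : ZMod p) ≠ 0 := by rwa [Ne, ZMod.intCast_zmod_eq_zero_iff_dvd]
  have hcount : pointCountAtPrime (mordellCurve k) P = q := by
    rw [pointCountAtPrime_mordellCurve hp hk₀ hka P f hf, hpq]
  have habs : Ideal.absNorm P.asIdeal = p := absNorm_eq_of_ker_eq hf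
  obtain ⟨π₀, hπ₀f, hπ₀n, hπ₀T⟩ := hψ.exists_frobenius hω6 hσ hp hk₀'
  have hspan₀ : Ideal.span {π₀} = P.asIdeal := (span_eq_ker_of_mul_conj hnorm hπ₀n hπ₀f).trans hf
  have hqO : (q : 𝓞 K) = p + 1 - (π₀ + σ π₀) := by
    rw [← hpq]; push_cast; rw [hπ₀T]; ring
  have hval (π : 𝓞 K) : IsGrossencharacterValue (mordellCurve k) P π ↔
      Ideal.span {π} = P.asIdeal ∧ (q : 𝓞 K) = p + 1 - (π + σ π) := by
    have h : ((pointCountAtPrime (mordellCurve k) P : ℤ) = (Ideal.absNorm P.asIdeal : ℤ) + 1 -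
        Algebra.trace ℤ (𝓞 K) π) ↔ (q : 𝓞 K) = p + 1 - (π + σ π) := by
      rw [hcount, habs, ← (hσx π).1]
      exact_mod_cast (Int.cast_inj (α := 𝓞 K)).symm
    exact ⟨fun hπ => ⟨hπ.1, h.1 hπ.2⟩, fun hπ => ⟨hπ.1, h.2 hπ.2⟩⟩
  have hπn (π : 𝓞 K) (hπ : IsGrossencharacterValue (mordellCurve k) P π) : π * σ π = p := by
    rw [mul_conj_eq_of_span_eq hω6 hσ (((hval π).1 hπ).1.trans hspan₀.symm), hπ₀n]
  have hπq (π : 𝓞 K) (hπ : IsGrossencharacterValue (mordellCurve k) P π) :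
      (1 - π) * σ (1 - π) = q := by
    rw [((hval π).1 hπ).2, map_sub, map_one]
    linear_combination hπn π hπ
  have hg (π : 𝓞 K) (hπ : IsGrossencharacterValue (mordellCurve k) P π) :
      ∃ g : 𝓞 K →+* ZMod q, RingHom.ker g = Ideal.span {1 - π} :=
    exists_ringHom_zmod_of_absNorm_eq _ (absNorm_span_of_mul_conj hnorm (hπq π hπ))
  have hval₀ : IsGrossencharacterValue (mordellCurve k) P π₀ := (hval π₀).2 ⟨hspan₀, hqO⟩
  -- The residue field of (1 - π₀) is 𝔽_q, and it contains the image of ω.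
  have hq6 : 6 ∣ q - 1 := by
    obtain ⟨g, -⟩ := hg π₀ hval₀
    exact six_dvd_sub_one hω6 hq g
  refine ⟨⟨π₀, hval₀, fun π hπ => ?_⟩, fun hpk => ?_, fun π hπ => ?_⟩
  · have htr : π + σ π = π₀ + σ π₀ := by
      linear_combination ((hval π).1 hπ).2 - hqO
    -- Equal trace and norm make π a root of (X - π₀)(X - σπ₀).
    have h0 : (π - π₀) * (π - σ π₀) = 0 := by
      linear_combination π * htr - hπn π hπ + hπ₀n
    refine sub_eq_zero.1 ((mul_eq_zero.1 h0).resolve_right fun h => ?_)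
    have hπf : f π = 0 := by
      rw [← RingHom.mem_ker, hf, ← ((hval π).1 hπ).1]
      exact Ideal.mem_span_singleton_self π
    have hσf : f (σ π₀) = 0 := by rw [← sub_eq_zero.1 h, hπf]
    refine not_dvd_trace_of_mod_six hp (six_dvd_sub_one hω6 hp f) hq6 hq hpq ?_ ?_
    · have := mordellCount_le (ringChar_zmod_ne_two hp) (k₀ : ZMod p)
      rwa [ZMod.card] at this
    · rw [← ZMod.intCast_zmod_eq_zero_iff_dvd]
      have hT := congr_arg f hπ₀T
      rw [map_natCast, map_sub, map_add, hπ₀f, hσf, map_natCast] at hT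
      push_cast
      rw [hT]
      ring
  · have ha : a = 0 := by
      by_contra ha
      exact hpk (hka ▸ (dvd_pow_self _ (by omega)).mul_right _)
    have hkk : k = k₀ := by rw [hka, ha]; simp
    have hfk : f (k : 𝓞 K) = k₀ := by rw [map_intCast, hkk]
    rw [sexticSymbol_eq hp hf hψ (by rwa [hfk]), hfk]
    obtain ⟨i, hi, hi'⟩ := hω6.eq_pow_of_pow_eq_one (hψ.apply_pow_six hk₀')
    have h2 : ψ k₀ ^ 2 ≠ 1 := fun h => by
      have := hψ.two_dvd_mordellCount_add_one hω6 hp h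
      omega
    have h3 : ψ k₀ ^ 3 ≠ 1 := fun h => by
      have := hψ.three_dvd_mordellCount_add_one hω6 hp h
      omega
    rw [← hi', ← pow_mul] at h2 h3
    rw [Ne, hω6.pow_eq_one_iff_dvd] at h2 h3
    rw [← hi']
    have : i = 1 ∨ i = 5 := by omega
    rcases this with rfl | rfl
    · exact Or.inl (pow_one ω)
    · exact Or.inr rfl
  · obtain ⟨g, hgk⟩ := hg π hπ
    obtain ⟨φ, hφ⟩ := exists_isSexticChar hω6 hq g
    have h2p : (2 : ZMod p) ≠ 0 := by
      exact_mod_cast natCast_ne_zero_of_lt_prime hpp (CharP.cast_eq_zero (ZMod p) p)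
        two_ne_zero (by omega)
    have h2q : (2 : ZMod q) ≠ 0 := by
      exact_mod_cast natCast_ne_zero_of_lt_prime hqq (CharP.cast_eq_zero (ZMod q) q)
        two_ne_zero (by omega)
    have hcub := cubic_apply_two_mul_eq_one hω6 hσ hnorm hp hq
      (((hval π).1 hπ).1.trans hf.symm) hgk.symm (hπn π hπ) (hπq π hπ) hψ hφ
    rw [sexticSymbol_eq hp hf hψ (by rwa [map_ofNat]),
      sexticSymbol_eq hq hgk hφ (by rwa [map_ofNat]), map_ofNat f, map_ofNat g]
    have hquadp := congr_arg (fun χ : MulChar (ZMod p) (𝓞 K) => χ 2) (hψ.pow_three_eq hω6 hp)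
    have hquadq := congr_arg (fun χ : MulChar (ZMod q) (𝓞 K) => χ 2) (hφ.pow_three_eq hω6 hq)
    simp only [MulChar.pow_apply' _ three_ne_zero, MulChar.ringHomComp_apply,
      eq_intCast] at hquadp hquadq
    have hz : (ψ 2 * φ 2) ^ 2 = 1 := by rw [mul_pow, hcub]
    refine ⟨?_, mul_self_eq_one_iff.1 (by rw [← sq, hz])⟩
    rw [legendreSym, legendreSym, Int.cast_mul, Int.cast_ofNat, Int.cast_ofNat, ← hquadp, ← hquadq]
    -- An element whose square is 1 equals its cube, here the product of the quadratic characters.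
    linear_combination (-(ψ 2 * φ 2)) * hz
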